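/- Let $\lambda,\lambda',\xi,\xi',\gamma,\rho,\mu,p,b,c,\sigma\in\mathbb{C}$ with $\sigma\neq0$, let $a\in\mathbb{N}$, let $\alpha>0$ and $x>0$ be real, and put $1/\Gamma=0$ at the poles of $\Gamma$. All powers of positive numbers are principal. Define: - the generalized Struve function $${}_a\mathcal{W}^{\alpha,\mu}_{p,b,c,\sigma}(z)=\sum_{k=0}^{\infty}\frac{(-c)^k}{\Gamma(\alpha k+\mu)\,\Gamma\!\left(ak+\frac p\sigma+\frac{b+2}{2}\right)}\left(\frac z2\right)^{2k+p+1};$$ - the Fox–Wright function $${}_m\Psi_n\!\left[\begin{matrix}(a_i,\alpha_i)_{1,m}\\(b_j,\beta_j)_{1,n}\end{matrix}\,\Big|\,z\right]=\sum_{k=0}^\infty\frac{\prod_{i=1}^m\Gamma(a_i+\alpha_ik)}{\prod_{j=1}^n\Gamma(b_j+\beta_jk)}\frac{z^k}{k!};$$ - for $\Re\gamma>0$, the left-sided Marichev–Saigo–Maeda fractional integral $$\left(I_{0+}^{\lambda,\lambda',\xi,\xi',\gamma}f\right)(x)=\frac{x^{-\lambda}}{\Gamma(\gamma)}\int_0^x(x-t)^{\gamma-1}t^{-\lambda'}F_3\!\left(\lambda,\lambda',\xi,\xi';\gamma;1-\frac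 tx,1-\frac xt\right)f(t)\,dt,$$ where $F_3(\lambda,\lambda',\xi,\xi';\gamma;u,v)=\sum_{m,n\ge0}\frac{(\lambda)_m(\lambda')_n(\xi)_m(\xi')_n}{(\gamma)_{m+n}\,m!\,n!}u^mv^n$ for $|u|,|v|<1$ is Appell's function, continued analytically in $v$ along the real half-line $v<1$. Assume $\Re\gamma>0$ and $$\Re(\rho+p+1)>\max\{0,\ \Re(\lambda+\lambda'+\xi-\gamma),\ \Re(\lambda'-\xi')\}.$$ Then the Struve series converges absolutely at every $t>0$, the integral defining the left-hand side below is absolutely convergent, the Fox–Wright series on the right converges absolutely, and $$\left(I_{0+}^{\lambda,\lambda',\xi,\xi',\gamma}\,t^{\rho-1}{}_a\mathcal{W}^{\alpha,\mu}_{p,b,c,\sigma}(t)\right)(x)=\frac{x^{\rho+p-\lambda-\lambda'+\gamma}}{2^{p+1}}\;{}_4\Psi_5\!\left[\begin{matrix}A\\B\end{matrix}\,\Big|\,-\frac{cx^2}{4}\right],$$ where $$A=(\rho+p+1,2),\ (\rho+p+1+\gamma-\lambda-\lambda'-\xi,2),\ (\rho+p+1+\xi'-\lambda',2),\ (1,1),$$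 $$B=(\rho+p+1+\xi',2),\ (\rho+p+1+\gamma-\lambda-\lambda',2),\ (\rho+p+1+\gamma-\lambda'-\xi,2),\ (\mu,\alpha),\ \left(\tfrac p\sigma+\tfrac{b+2}{2},a\right).$$ In particular, this holds with $\sigma=\xi$ when $\xi\neq0$. -/

import Mathlib

/-- The Appell double series
`F₃(a, a', b, b'; c; u, v) = ∑ (a)ₘ (a')ₙ (b)ₘ (b')ₙ / ((c)ₘ₊ₙ m! n!) uᵐ vⁿ`,
absolutely convergent for `|u| < 1`, `|v| < 1` (when `c` is not a non-positive integer). -/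
noncomputable def appellF3Series (a a' b b' c u v : ℂ) : ℂ :=
  ∑' q : ℕ × ℕ,
    ((ascPochhammer ℂ q.1).eval a * (ascPochhammer ℂ q.2).eval a' *
        (ascPochhammer ℂ q.1).eval b * (ascPochhammer ℂ q.2).eval b') /
      ((ascPochhammer ℂ (q.1 + q.2)).eval c * (q.1.factorial : ℂ) * (q.2.factorial : ℂ)) *
      u ^ q.1 * v ^ q.2

/-- `g` is the analytic continuation, along the real half-line `v < 1`, of the function
`v ↦ F₃(a, a', b, b'; c; u, v)` given by the double series for `-1 < v < 1`. -/
def IsAppellF3Continuation (a a' b b' c u : ℂ) (g : ℝ → ℂ) : Prop :=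
  AnalyticOnNhd ℝ g (Set.Iio 1) ∧
    ∀ v ∈ Set.Ioo (-1 : ℝ) 1, g v = appellF3Series a a' b b' c u (v : ℂ)

/-- The continuation is unique. -/
theorem IsAppellF3Continuation.eqOn {a a' b b' c u : ℂ} {g h : ℝ → ℂ}
    (hg : IsAppellF3Continuation a a' b b' c u g)
    (hh : IsAppellF3Continuation a a' b b' c u h) : Set.EqOn g h (Set.Iio 1) := by
  refine hg.1.eqOn_of_preconnected_of_eventuallyEq hh.1 isPreconnected_Iio
    (z₀ := 0) (by simp) ?_
  filter_upwards [Ioo_mem_nhds (show (-1 : ℝ) < 0 by norm_num) one_pos] with v hv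
  rw [hg.2 v hv, hh.2 v hv]

open Classical in
/-- The Appell function `F₃(a, a', b, b'; c; u, v)` for `|u| < 1` and real `v < 1`: the analytic
continuation in `v` of the double series. (It is the restriction to real `v` of the branch that
is holomorphic for `|u| < 1`, `v ∈ ℂ ∖ [1, ∞)`.) -/
noncomputable def appellF3 (a a' b b' c u : ℂ) (v : ℝ) : ℂ :=
  if h : ∃ g : ℝ → ℂ, IsAppellF3Continuation a a' b b' c u g then h.choose v else 0

/-- The integrand `(x - t)^(γ-1) t^(-λ') F₃(λ, λ', ξ, ξ'; γ; 1 - t/x, 1 - x/t) f(t)` of the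
left-sided Marichev–Saigo–Maeda integral. -/
noncomputable def msmIntegrand (lam lam' ξ ξ' γ : ℂ) (f : ℝ → ℂ) (x t : ℝ) : ℂ :=
  ((x - t : ℝ) : ℂ) ^ (γ - 1) * (t : ℂ) ^ (-lam') *
    appellF3 lam lam' ξ ξ' γ ((1 - t / x : ℝ) : ℂ) (1 - x / t) * f t

/-- The left-sided Marichev–Saigo–Maeda fractional integral of `f` at `x > 0`. -/
noncomputable def msmIntegral (lam lam' ξ ξ' γ : ℂ) (f : ℝ → ℂ) (x : ℝ) : ℂ :=
  (x : ℂ) ^ (-lam) / Complex.Gamma γ *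
    ∫ t in (0 : ℝ)..x, msmIntegrand lam lam' ξ ξ' γ f x t

/-- The `k`-th term of the generalized Struve series. Division by a value of `Complex.Gamma` at
a pole gives `0`, which is the usual convention `1 / Γ = 0` there. -/
noncomputable def struveTerm (a : ℕ) (α : ℝ) (μ p b c σ z : ℂ) (k : ℕ) : ℂ :=
  (-c) ^ k / (Complex.Gamma ((α : ℂ) * k + μ) *
      Complex.Gamma ((a : ℂ) * k + p / σ + (b + 2) / 2)) *
    (z / 2) ^ (2 * (k : ℂ) + p + 1)

/-- The generalized Struve function `ₐW^{α,μ}_{p,b,c,σ}(z)`, with principal powers. -/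
noncomputable def generalizedStruve (a : ℕ) (α : ℝ) (μ p b c σ z : ℂ) : ℂ :=
  ∑' k : ℕ, struveTerm a α μ p b c σ z k

/-- The `k`-th term of the Fox–Wright series with upper pairs `A i = (aᵢ, αᵢ)` and lower pairs
`B j = (bⱼ, βⱼ)`. -/
noncomputable def foxWrightTerm {m n : ℕ} (A : Fin m → ℂ × ℝ) (B : Fin n → ℂ × ℝ) (z : ℂ)
    (k : ℕ) : ℂ :=
  (∏ i, Complex.Gamma ((A i).1 + ((A i).2 : ℂ) * k)) /
    (∏ j, Complex.Gamma ((B j).1 + ((B j).2 : ℂ) * k)) * (z ^ k / (k.factorial : ℂ))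

/-- The Fox–Wright function `ₘΨₙ[A; B | z]`. -/
noncomputable def foxWright {m n : ℕ} (A : Fin m → ℂ × ℝ) (B : Fin n → ℂ × ℝ) (z : ℂ) : ℂ :=
  ∑' k : ℕ, foxWrightTerm A B z k

/-- The upper parameters of the `₄Ψ₅` in the image formula. -/
def imageUpper (lam lam' ξ ξ' γ ρ p : ℂ) : Fin 4 → ℂ × ℝ :=
  ![(ρ + p + 1, 2), (ρ + p + 1 + γ - lam - lam' - ξ, 2), (ρ + p + 1 + ξ' - lam', 2), (1, 1)]

/-- The lower parameters of the `₄Ψ₅` in the image formula. -/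
noncomputable def imageLower (lam lam' ξ ξ' γ ρ : ℂ) (a : ℕ) (α : ℝ) (μ p b σ : ℂ) :
    Fin 5 → ℂ × ℝ :=
  ![(ρ + p + 1 + ξ', 2), (ρ + p + 1 + γ - lam - lam', 2), (ρ + p + 1 + γ - lam' - ξ, 2),
    (μ, α), (p / σ + (b + 2) / 2, (a : ℝ))]

/-! Write `u = 1 - t / x` and `v = 1 - x / t`. Since `v / (v - 1) = u`, Pfaff's transformation in
`v` turns `F₃` on `0 < t < x` into `(x / t)^(-λ') ∑ dₘₙ u^(m+n)`, and the image of `t^(s-1)`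
becomes a series of beta integrals; Gauss's summation theorem, applied first to the sum over `n`
and then to the sum over `m`, evaluates it as a quotient of Gamma functions. The double series of
absolute integrals converges only when `Re λ' > 0`; the remaining `λ'` are reached by induction
from a contiguous relation that expresses the transformed series for `λ'` through two series for
`λ' + 1`, and the Gamma quotients satisfy the same relation. The Struve series is then integrated
term by term, its absolute convergence coming from the superexponential decay of `1 / Γ(α k + μ)`.
-/

open Asymptotics Filter Topology MeasureTheory
open scoped Nat

section RisingFactorial

/-- The rising factorial `(z)ₙ = z (z + 1) ⋯ (z + n - 1)`. -/
noncomputable def rising (z : ℂ) (n : ℕ) : ℂ := (ascPochhammer ℂ n).eval z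

@[simp] theorem rising_zero (z : ℂ) : rising z 0 = 1 := by simp [rising]

theorem rising_succ (z : ℂ) (n : ℕ) : rising z (n + 1) = rising z n * (z + n) :=
  ascPochhammer_succ_eval n z

theorem rising_add (z : ℂ) (m n : ℕ) : rising z (m + n) = rising z m * rising (z + m) n := by
  induction n with
  | zero => simp
  | succ n ih => rw [← add_assoc, rising_succ, ih, rising_succ]; push_cast; ring

theorem rising_succ_left (z : ℂ) (n : ℕ) : rising z (n + 1) = z * rising (z + 1) n := by
  rw [add_comm, rising_add]; simp [rising]

theorem rising_eq_prod (z : ℂ) (n : ℕ) : rising z n = ∏ j ∈ Finset.range n, (z + j) := by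
  induction n with
  | zero => simp
  | succ n ih => rw [rising_succ, ih, Finset.prod_range_succ]

theorem norm_rising_le_norm_rising {z w : ℂ} (hre : ∀ j : ℕ, |z.re + j| ≤ |w.re + j|)
    (him : |z.im| ≤ |w.im|) (n : ℕ) : ‖rising z n‖ ≤ ‖rising w n‖ := by
  simp only [rising_eq_prod, norm_prod]
  gcongr with j
  rw [Complex.norm_eq_sqrt_sq_add_sq, Complex.norm_eq_sqrt_sq_add_sq]
  have h := add_le_add (sq_le_sq.2 (hre j)) (sq_le_sq.2 him)
  exact Real.sqrt_le_sqrt (by simpa using h)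

theorem rising_ne_zero {z : ℂ} (hz : ∀ k : ℕ, z ≠ -k) (n : ℕ) : rising z n ≠ 0 := by
  rw [rising_eq_prod, Finset.prod_ne_zero_iff]
  exact fun k _ h => hz k (eq_neg_of_add_eq_zero_left h)

theorem ne_neg_natCast_of_re_pos {z : ℂ} (hz : 0 < z.re) (k : ℕ) : z ≠ -k := by
  rintro rfl
  exact hz.not_ge (by simp)

theorem re_add_natCast_pos {z : ℂ} (hz : 0 < z.re) (n : ℕ) : 0 < (z + n).re := by
  rw [Complex.add_re, Complex.natCast_re]; positivity

theorem inv_Gamma_eq_rising_mul (z : ℂ) (n : ℕ) :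
    (Complex.Gamma z)⁻¹ = rising z n * (Complex.Gamma (z + n))⁻¹ := by
  induction n with
  | zero => simp
  | succ n ih =>
    rw [ih, Complex.one_div_Gamma_eq_self_mul_one_div_Gamma_add_one, rising_succ]
    push_cast
    ring_nf

theorem Gamma_add_natCast {z : ℂ} (hz : 0 < z.re) (n : ℕ) :
    Complex.Gamma (z + n) = rising z n * Complex.Gamma z :=
  (div_eq_iff (Complex.Gamma_ne_zero_of_re_pos hz)).1
    (Complex.Gamma_add_nat_div_Gamma_eq z (ne_neg_natCast_of_re_pos hz))

end RisingFactorial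

section GammaAsymptotics

/-- The comparison sequence `n! (n + 1)^(z - 1)` for `Γ(z + n)` as `n → ∞`. The base `n + 1` keeps
it nonzero at `n = 0`. -/
noncomputable def gammaScale (z : ℂ) (n : ℕ) : ℂ := n ! * ((n + 1 : ℕ) : ℂ) ^ (z - 1)

/-- The modulus `n! (n + 1)^(r - 1)` of `gammaScale z n` for `Re z = r`. -/
noncomputable def gammaWeight (r : ℝ) (n : ℕ) : ℝ := n ! * ((n : ℝ) + 1) ^ (r - 1)

theorem norm_gammaScale (z : ℂ) (n : ℕ) : ‖gammaScale z n‖ = gammaWeight z.re n := by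
  rw [gammaScale, norm_mul, Complex.norm_natCast,
    Complex.norm_natCast_cpow_of_pos n.succ_pos, gammaWeight]
  simp

theorem gammaWeight_pos (r : ℝ) (n : ℕ) : 0 < gammaWeight r n := by
  unfold gammaWeight; positivity

theorem gammaScale_ne_zero (z : ℂ) (n : ℕ) : gammaScale z n ≠ 0 := by
  rw [← norm_pos_iff, norm_gammaScale]; exact gammaWeight_pos _ _

theorem gammaScale_add_one (z : ℂ) (n : ℕ) :
    gammaScale (z + 1) n = gammaScale z n * (n + 1) := by
  rw [gammaScale, gammaScale, show z + 1 - 1 = z - 1 + 1 by ring,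
    Complex.cpow_add _ _ (by exact_mod_cast n.succ_ne_zero), Complex.cpow_one]
  push_cast
  ring

theorem gammaScale_sub_mul_gammaScale_sub (a b c : ℂ) (n : ℕ) :
    gammaScale (c - a) n * gammaScale (c - b) n =
      gammaScale (c - a - b) n * gammaScale c n := by
  have hn : ((n + 1 : ℕ) : ℂ) ≠ 0 := by exact_mod_cast n.succ_ne_zero
  have h : ((n + 1 : ℕ) : ℂ) ^ (c - a - 1) * ((n + 1 : ℕ) : ℂ) ^ (c - b - 1) =
      ((n + 1 : ℕ) : ℂ) ^ (c - a - b - 1) * ((n + 1 : ℕ) : ℂ) ^ (c - 1) := by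
    rw [← Complex.cpow_add _ _ hn, ← Complex.cpow_add _ _ hn]
    ring_nf
  unfold gammaScale
  linear_combination (n ! : ℂ) ^ 2 * h

theorem tendsto_add_natCast_div_add_one (z : ℂ) :
    Tendsto (fun n : ℕ => (z + n) / ((n : ℂ) + 1)) atTop (𝓝 1) := by
  have h : Tendsto (fun n : ℕ => (z - 1) * (1 / ((n : ℂ) + 1)) + 1) atTop (𝓝 1) := by
    simpa using (tendsto_one_div_add_atTop_nhds_zero_nat (𝕜 := ℂ)).const_mul (z - 1) |>.add_const 1
  refine h.congr fun n => ?_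
  field_simp [Nat.cast_add_one_ne_zero (R := ℂ) n]
  ring

theorem tendsto_gammaScale_div_Gamma_of_re_pos {z : ℂ} (hz : 0 < z.re) :
    Tendsto (fun n : ℕ => gammaScale z n * (Complex.Gamma (z + n))⁻¹) atTop (𝓝 1) := by
  have hG := Complex.Gamma_ne_zero_of_re_pos hz
  have hseq : Tendsto (fun n : ℕ => Complex.GammaSeq z (n + 1) / Complex.Gamma z) atTop (𝓝 1) := by
    rw [← div_self hG]
    exact ((tendsto_add_atTop_iff_nat 1).2 (Complex.GammaSeq_tendsto_Gamma z)).div_const _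
  have h := (hseq.mul (tendsto_add_natCast_div_add_one z)).mul
    (tendsto_add_natCast_div_add_one (z + 1))
  rw [one_mul, one_mul] at h
  refine h.congr fun n => ?_
  have hseq : Complex.GammaSeq z (n + 1) =
      gammaScale z n * (n + 1) ^ 2 / (rising z n * (z + n) * (z + 1 + n)) := by
    have hprod := rising_eq_prod z (n + 1 + 1)
    rw [rising_succ, rising_succ] at hprod
    have hpow : ((n + 1 : ℕ) : ℂ) ^ z = ((n + 1 : ℕ) : ℂ) ^ (z - 1) * (n + 1 : ℕ) := by
      rw [← sub_add_cancel z 1, Complex.cpow_add _ _ (by exact_mod_cast n.succ_ne_zero),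
        Complex.cpow_one, sub_add_cancel]
    rw [Complex.GammaSeq, ← hprod, Nat.factorial_succ, hpow, gammaScale]
    push_cast
    ring_nf
  have hr := rising_ne_zero (ne_neg_natCast_of_re_pos hz) n
  have hzn : z + n ≠ 0 := ne_of_apply_ne Complex.re (re_add_natCast_pos hz n).ne'
  have hzn' : z + 1 + n ≠ 0 :=
    ne_of_apply_ne Complex.re (re_add_natCast_pos (by simpa using hz.trans (lt_add_one _)) n).ne'
  rw [hseq, Gamma_add_natCast hz]
  field_simp [Nat.cast_add_one_ne_zero (R := ℂ) n]

theorem tendsto_gammaScale_div_Gamma (z : ℂ) :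
    Tendsto (fun n : ℕ => gammaScale z n * (Complex.Gamma (z + n))⁻¹) atTop (𝓝 1) := by
  obtain ⟨k, hk⟩ := exists_nat_gt (-z.re)
  rw [neg_lt_iff_pos_add] at hk
  induction k generalizing z with
  | zero => exact tendsto_gammaScale_div_Gamma_of_re_pos (by simpa using hk)
  | succ k ih =>
    have h := (ih (z + 1) (by push_cast at hk; simpa [add_assoc, add_comm (1 : ℝ)] using hk)).mul
      (tendsto_add_natCast_div_add_one z)
    rw [one_mul] at h
    refine h.congr fun n => ?_
    rw [Complex.one_div_Gamma_eq_self_mul_one_div_Gamma_add_one (z + n), gammaScale_add_one]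
    field_simp [Nat.cast_add_one_ne_zero (R := ℂ) n]
    ring_nf

theorem tendsto_rising_div_gammaScale (z : ℂ) :
    Tendsto (fun n : ℕ => rising z n / gammaScale z n) atTop (𝓝 (Complex.Gamma z)⁻¹) := by
  have h := tendsto_gammaScale_div_Gamma z
  have hlim := (tendsto_const_nhds (x := (Complex.Gamma z)⁻¹)).div h one_ne_zero
  rw [div_one] at hlim
  refine hlim.congr' ?_
  filter_upwards [h.eventually_ne one_ne_zero] with n hn
  rw [Pi.div_apply, inv_Gamma_eq_rising_mul z n, mul_div_mul_right _ _ (right_ne_zero_of_mul hn)]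

theorem isBigO_top_of_tendsto_div {f g : ℕ → ℂ} {L : ℂ} (hg : ∀ n, g n ≠ 0)
    (h : Tendsto (fun n => f n / g n) atTop (𝓝 L)) : f =O[⊤] g := by
  have hO : f =O[atTop] g :=
    isBigO_of_div_tendsto_nhds (Eventually.of_forall fun n hn => absurd hn (hg n)) L h
  exact isBigO_top.2 ((isBigO_nat_atTop_iff fun n hn => absurd hn (hg n)).1 hO)

theorem isBigO_top_comp {ι κ E F : Type*} [Norm E] [Norm F] {f : ι → E} {g : ι → F}
    (h : f =O[⊤] g) (k : κ → ι) : (fun i => f (k i)) =O[⊤] fun i => g (k i) :=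
  h.comp_tendsto tendsto_top

theorem gammaScale_isTheta (z : ℂ) : gammaScale z =Θ[⊤] gammaWeight z.re :=
  IsTheta.of_norm_eventuallyEq_norm <| Eventually.of_forall fun n => by
    simp [norm_gammaScale, abs_of_pos (gammaWeight_pos _ _)]

theorem rising_isBigO (z : ℂ) : rising z =O[⊤] gammaWeight z.re :=
  (isBigO_top_of_tendsto_div (gammaScale_ne_zero z) (tendsto_rising_div_gammaScale z)).trans
    (gammaScale_isTheta z).1

theorem inv_rising_isBigO {z : ℂ} (hz : ∀ k : ℕ, z ≠ -k) :
    (fun n => (rising z n)⁻¹) =O[⊤] fun n => (gammaWeight z.re n)⁻¹ := by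
  have h := (tendsto_rising_div_gammaScale z).inv₀ (inv_ne_zero (Complex.Gamma_ne_zero hz))
  simp only [inv_div] at h
  exact ((gammaScale_isTheta z).2.trans (isBigO_top_of_tendsto_div (rising_ne_zero hz) h)).inv_rev
    (Eventually.of_forall fun n h => absurd h (gammaWeight_pos _ n).ne')

theorem inv_Gamma_add_natCast_isBigO (z : ℂ) :
    (fun n : ℕ => (Complex.Gamma (z + n))⁻¹) =O[⊤] fun n => (gammaWeight z.re n)⁻¹ := by
  have h : Tendsto (fun n : ℕ => (Complex.Gamma (z + n))⁻¹ / (gammaScale z n)⁻¹) atTop (𝓝 1) := by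
    simpa only [div_inv_eq_mul, mul_comm] using tendsto_gammaScale_div_Gamma z
  exact (isBigO_top_of_tendsto_div (fun n => inv_ne_zero (gammaScale_ne_zero z n)) h).trans
    (gammaScale_isTheta z).inv.1

-- A larger imaginary part increases every factor `|z + m + j|` and moves `z` off the poles of `Γ`.
theorem rising_add_natCast_isBigO (z : ℂ) :
    (fun q : ℕ × ℕ => rising (z + q.1) q.2) =O[⊤]
      fun q => gammaWeight z.re (q.1 + q.2) / gammaWeight z.re q.1 := by
  set w : ℂ := ⟨z.re, |z.im| + 1⟩ with hw
  have hwk (k : ℕ) : w ≠ -k := ne_of_apply_ne Complex.im (by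
    simpa [hw] using (add_pos_of_nonneg_of_pos (abs_nonneg z.im) one_pos).ne')
  have hzw : (fun q : ℕ × ℕ => rising (z + q.1) q.2) =O[⊤] fun q => rising (w + q.1) q.2 := by
    refine isBigO_of_le _ fun q => norm_rising_le_norm_rising (fun j => ?_) ?_ _
    · simp [hw]
    · simpa [hw] using (le_add_of_nonneg_right zero_le_one).trans (le_abs_self _)
  have hquot : (fun q : ℕ × ℕ => rising (w + q.1) q.2) =
      fun q => rising w (q.1 + q.2) * (rising w q.1)⁻¹ := by
    ext q
    rw [rising_add, mul_comm (rising w q.1), mul_inv_cancel_right₀ (rising_ne_zero hwk q.1)]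
  rw [hquot] at hzw
  have hnum := isBigO_top_comp (rising_isBigO w) fun q : ℕ × ℕ => q.1 + q.2
  have hden := isBigO_top_comp (inv_rising_isBigO hwk) fun q : ℕ × ℕ => q.1
  exact hzw.trans (hnum.mul hden)

end GammaAsymptotics

section DoubleSeries

/-- The weight `(m + 1)^α (n + 1)^β (m + n + 1)^δ`, against which the coefficients of all the double
power series below are compared. -/
noncomputable def doubleWeight (α β δ : ℝ) (q : ℕ × ℕ) : ℝ :=
  ((q.1 : ℝ) + 1) ^ α * ((q.2 : ℝ) + 1) ^ β * ((q.1 : ℝ) + q.2 + 1) ^ δ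

theorem summable_natCast_add_one_rpow {r : ℝ} (hr : r < -1) :
    Summable fun n : ℕ => ((n : ℝ) + 1) ^ r := by
  simpa using (summable_nat_add_iff 1).2 (Real.summable_nat_rpow.2 hr)

theorem summable_rpow_mul_geometric (r : ℝ) {x : ℝ} (h0 : 0 ≤ x) (h1 : x < 1) :
    Summable fun n : ℕ => ((n : ℝ) + 1) ^ r * x ^ n := by
  obtain ⟨M, hM⟩ := exists_nat_ge r
  obtain ⟨y, hxy, hy⟩ := exists_between h1
  have hy0 : 0 < y := h0.trans_lt hxy
  have hs := ((summable_nat_add_iff 1).2 (summable_pow_mul_geometric_of_norm_lt_one M (r := y)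
    (by rwa [Real.norm_of_nonneg hy0.le]))).mul_right y⁻¹
  refine .of_nonneg_of_le (fun n => by positivity) (fun n => ?_) hs
  have hr : ((n : ℝ) + 1) ^ r ≤ ((n : ℝ) + 1) ^ M := by
    rw [← Real.rpow_natCast]
    exact Real.rpow_le_rpow_of_exponent_le (by simp) hM
  calc ((n : ℝ) + 1) ^ r * x ^ n ≤ ((n : ℝ) + 1) ^ M * y ^ n := by gcongr
    _ = ((n + 1 : ℕ) : ℝ) ^ M * y ^ (n + 1) * y⁻¹ := by
      rw [pow_succ, ← mul_assoc, mul_inv_cancel_right₀ hy0.ne', Nat.cast_succ]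

theorem doubleWeight_le (α β : ℝ) {δ₁ δ₂ : ℝ} (h₁ : δ₁ ≤ 0) (h₂ : δ₂ ≤ 0) (q : ℕ × ℕ) :
    doubleWeight α β (δ₁ + δ₂) q ≤ ((q.1 : ℝ) + 1) ^ (α + δ₁) * ((q.2 : ℝ) + 1) ^ (β + δ₂) := by
  have hm : (0 : ℝ) < q.1 + 1 := by positivity
  have hn : (0 : ℝ) < q.2 + 1 := by positivity
  rw [doubleWeight, Real.rpow_add hm, Real.rpow_add hn, Real.rpow_add (by positivity)]
  calc _ ≤ ((q.1 : ℝ) + 1) ^ α * ((q.2 : ℝ) + 1) ^ β *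
        (((q.1 : ℝ) + 1) ^ δ₁ * ((q.2 : ℝ) + 1) ^ δ₂) := by
        gcongr _ * (?_ * ?_)
        · exact Real.rpow_le_rpow_of_nonpos hm (by linarith [q.2.cast_nonneg (α := ℝ)]) h₁
        · exact Real.rpow_le_rpow_of_nonpos hn (by linarith [q.1.cast_nonneg (α := ℝ)]) h₂
    _ = _ := by ring

theorem summable_doubleWeight {α β δ : ℝ} (hβ : -1 < β) (hβδ : β + δ < -1)
    (hαβδ : α + β + δ < -2) : Summable (doubleWeight α β δ) := by
  obtain ⟨ε, hε, h⟩ := exists_between (lt_min (a := 0) (b := -1 - (β + δ))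
    (c := -2 - (α + β + δ)) (by linarith) (by linarith))
  obtain ⟨hε₁, hε₂⟩ := lt_min_iff.1 h
  have hs := (summable_natCast_add_one_rpow (r := α + (δ + (1 + β + ε)))
      (by linarith)).mul_of_nonneg
    (summable_natCast_add_one_rpow (r := β + -(1 + β + ε)) (by linarith))
    (fun n => by positivity) (fun n => by positivity)
  refine .of_nonneg_of_le (fun q => by unfold doubleWeight; positivity) (fun q => ?_) hs
  simpa only [add_neg_cancel_right] using
    doubleWeight_le α β (δ₁ := δ + (1 + β + ε)) (δ₂ := -(1 + β + ε)) (by linarith) (by linarith) q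

variable {d : ℕ × ℕ → ℂ} {α β δ : ℝ}

theorem summable_mul_pow_of_isBigO_doubleWeight (hd : d =O[⊤] doubleWeight α β δ) {u v : ℂ}
    (hu : ‖u‖ < 1) (hv : ‖v‖ < 1) : Summable fun q : ℕ × ℕ => d q * u ^ q.1 * v ^ q.2 := by
  have hs := (summable_rpow_mul_geometric (α + max δ 0) (norm_nonneg u) hu).mul_of_nonneg
    (summable_rpow_mul_geometric (β + max δ 0) (norm_nonneg v) hv)
    (fun n => by positivity) (fun n => by positivity)
  obtain ⟨C, hC⟩ := isBigO_top.1 hd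
  refine .of_norm_bounded (hs.mul_left |C|) fun q => ?_
  have hm : (0 : ℝ) < q.1 + 1 := by positivity
  have hn : (0 : ℝ) < q.2 + 1 := by positivity
  have hδ : ((q.1 : ℝ) + q.2 + 1) ^ δ ≤
      ((q.1 : ℝ) + 1) ^ max δ 0 * ((q.2 : ℝ) + 1) ^ max δ 0 := by
    rw [← Real.mul_rpow hm.le hn.le]
    refine (Real.rpow_le_rpow_of_exponent_le (by norm_cast; lia) (le_max_left δ 0)).trans ?_
    gcongr
    nlinarith [q.1.cast_nonneg (α := ℝ), q.2.cast_nonneg (α := ℝ)]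
  have hw : 0 ≤ doubleWeight α β δ q := by unfold doubleWeight; positivity
  rw [norm_mul, norm_mul, norm_pow, norm_pow]
  calc ‖d q‖ * ‖u‖ ^ q.1 * ‖v‖ ^ q.2
      ≤ |C| * doubleWeight α β δ q * ‖u‖ ^ q.1 * ‖v‖ ^ q.2 := by
        gcongr
        refine (hC q).trans ?_
        rw [Real.norm_of_nonneg hw]
        gcongr
        exact le_abs_self C
    _ ≤ |C| * (((q.1 : ℝ) + 1) ^ α * ((q.2 : ℝ) + 1) ^ β *
          (((q.1 : ℝ) + 1) ^ max δ 0 * ((q.2 : ℝ) + 1) ^ max δ 0)) * ‖u‖ ^ q.1 * ‖v‖ ^ q.2 := by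
        unfold doubleWeight
        gcongr
    _ = _ := by rw [Real.rpow_add hm, Real.rpow_add hn]; ring

theorem differentiableOn_tsum_of_isBigO_doubleWeight (hd : d =O[⊤] doubleWeight α β δ) {u : ℂ}
    (hu : ‖u‖ < 1) :
    DifferentiableOn ℂ (fun v : ℂ => ∑' q : ℕ × ℕ, d q * u ^ q.1 * v ^ q.2)
      (Metric.ball 0 1) := by
  intro v hv
  obtain ⟨r, hvr, hr⟩ := exists_between (mem_ball_zero_iff.1 hv)
  have hr0 : 0 ≤ r := (norm_nonneg v).trans hvr.le
  have hs := (summable_mul_pow_of_isBigO_doubleWeight hd hu (v := (r : ℂ)) (by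
    rwa [Complex.norm_real, Real.norm_of_nonneg hr0])).norm
  have hdiff := Complex.differentiableOn_tsum_of_summable_norm hs
    (F := fun q v => d q * u ^ q.1 * v ^ q.2) (U := Metric.ball 0 r)
    (fun q => by fun_prop) Metric.isOpen_ball fun q w hw => by
      rw [mem_ball_zero_iff] at hw
      rw [norm_mul, norm_mul _ ((r : ℂ) ^ q.2), norm_pow, norm_pow, Complex.norm_real,
        Real.norm_of_nonneg hr0]
      gcongr
  exact (hdiff.differentiableAt
    (Metric.isOpen_ball.mem_nhds (mem_ball_zero_iff.2 hvr))).differentiableWithinAt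

end DoubleSeries

section GaussSummation

/-- The `n`-th term `(a)ₙ (b)ₙ / (Γ(c + n) n!)` of the regularized hypergeometric series at `1`.
Dividing by `Γ(c + n)` rather than by `(c)ₙ` allows every complex `c`. -/
noncomputable def gaussTerm (a b c : ℂ) (n : ℕ) : ℂ :=
  rising a n * rising b n * (Complex.Gamma (c + n))⁻¹ / n !

theorem gaussTerm_isBigO (a b c : ℂ) :
    gaussTerm a b c =O[⊤] fun n : ℕ => ((n : ℝ) + 1) ^ (-(c - a - b).re - 1) := by
  have hfac : (fun n : ℕ => ((n ! : ℂ))⁻¹) =O[⊤] fun n : ℕ => ((n ! : ℝ))⁻¹ :=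
    isBigO_of_le _ fun n => by simp
  refine ((((rising_isBigO a).mul (rising_isBigO b)).mul
    (inv_Gamma_add_natCast_isBigO c)).mul hfac).congr_right fun n => ?_
  have hn : (0 : ℝ) < (n : ℝ) + 1 := by positivity
  have hf : (n ! : ℝ) ≠ 0 := by positivity
  rw [show -(c - a - b).re - 1 = (a.re - 1) + (b.re - 1) - (c.re - 1) by simp; ring,
    Real.rpow_sub hn, Real.rpow_add hn]
  simp only [gammaWeight]
  field_simp

theorem summable_gaussTerm {a b c : ℂ} (h : 0 < (c - a - b).re) : Summable (gaussTerm a b c) :=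
  summable_of_isBigO (summable_natCast_add_one_rpow (by linarith))
    ((gaussTerm_isBigO a b c).mono le_top)

theorem tendsto_natCast_mul_gaussTerm {a b c : ℂ} (h : 0 < (c - a - b).re) :
    Tendsto (fun n : ℕ => (n : ℂ) * gaussTerm a b c n) atTop (𝓝 0) := by
  have hn : (fun n : ℕ => (n : ℂ)) =O[⊤] fun n : ℕ => (n : ℝ) + 1 :=
    isBigO_of_le _ fun n => by
      rw [Complex.norm_natCast, Real.norm_of_nonneg (by positivity)]; linarith
  have hO : (fun n : ℕ => (n : ℂ) * gaussTerm a b c n) =O[⊤]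
      fun n : ℕ => ((n : ℝ) + 1) ^ (-(c - a - b).re) :=
    (hn.mul (gaussTerm_isBigO a b c)).congr_right fun n => by
      have hn : (n : ℝ) + 1 ≠ 0 := by positivity
      rw [Real.rpow_sub_one hn, mul_div_cancel₀ _ hn]
  refine (hO.mono le_top).trans_tendsto ?_
  exact (tendsto_rpow_neg_atTop h).comp
    (tendsto_atTop_add_const_right atTop (1 : ℝ) tendsto_natCast_atTop_atTop)

theorem sum_range_gaussTerm_contiguous (a b c : ℂ) (N : ℕ) :
    ∑ n ∈ Finset.range N, ((c - a - b) * gaussTerm a b c n -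
      (c - a) * (c - b) * gaussTerm a b (c + 1) n) = -((N : ℂ) * gaussTerm a b c N) := by
  induction N with
  | zero => simp
  | succ N ih =>
    rw [Finset.sum_range_succ, ih]
    simp only [gaussTerm]
    rw [Complex.one_div_Gamma_eq_self_mul_one_div_Gamma_add_one (c + N), rising_succ, rising_succ,
      Nat.factorial_succ, show c + ((N + 1 : ℕ) : ℂ) = c + N + 1 by push_cast; ring,
      show c + 1 + (N : ℂ) = c + N + 1 by ring]
    have hf : (N ! : ℂ) ≠ 0 := by exact_mod_cast N.factorial_ne_zero
    have hN : (N : ℂ) + 1 ≠ 0 := by exact_mod_cast N.succ_ne_zero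
    push_cast
    field_simp
    ring

theorem tsum_gaussTerm_contiguous {a b c : ℂ} (h : 0 < (c - a - b).re) :
    (c - a - b) * ∑' n, gaussTerm a b c n =
      (c - a) * (c - b) * ∑' n, gaussTerm a b (c + 1) n := by
  have h' : 0 < (c + 1 - a - b).re := by
    simp only [Complex.sub_re, Complex.add_re, Complex.one_re] at h ⊢; linarith
  have hs := ((summable_gaussTerm h).hasSum.mul_left (c - a - b)).sub
    ((summable_gaussTerm h').hasSum.mul_left ((c - a) * (c - b)))
  have hpartial := hs.tendsto_sum_nat
  simp only [sum_range_gaussTerm_contiguous] at hpartial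
  have hzero := (tendsto_natCast_mul_gaussTerm h).neg
  rw [neg_zero] at hzero
  exact sub_eq_zero.1 (tendsto_nhds_unique hpartial hzero)

theorem re_add_natCast_sub_sub_pos {a b c : ℂ} (h : 0 < (c - a - b).re) (n : ℕ) :
    0 < (c + n - a - b).re := by
  rw [show c + n - a - b = c - a - b + n by ring]
  exact re_add_natCast_pos h n

theorem rising_mul_tsum_gaussTerm {a b c : ℂ} (h : 0 < (c - a - b).re) (n : ℕ) :
    rising (c - a - b) n * ∑' k, gaussTerm a b c k =
      rising (c - a) n * rising (c - b) n * ∑' k, gaussTerm a b (c + n) k := by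
  induction n with
  | zero => simp
  | succ n ih =>
    have hstep := tsum_gaussTerm_contiguous (re_add_natCast_sub_sub_pos h n)
    rw [rising_succ, rising_succ, rising_succ, Nat.cast_succ, ← add_assoc]
    linear_combination (c - a - b + n) * ih + rising (c - a) n * rising (c - b) n * hstep

theorem norm_rising_le_norm_rising_add_natCast {z : ℂ} (hz : 0 < z.re) (n k : ℕ) :
    ‖rising z k‖ ≤ ‖rising (z + n) k‖ := by
  refine norm_rising_le_norm_rising (fun j => ?_) (by simp) k
  have hj := re_add_natCast_pos hz j
  simp only [Complex.add_re, Complex.natCast_re] at hj ⊢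
  exact abs_le_abs_of_nonneg hj.le (by linarith [n.cast_nonneg (α := ℝ)])

theorem Gamma_mul_gaussTerm {a b c : ℂ} (hc : 0 < c.re) (k : ℕ) :
    Complex.Gamma c * gaussTerm a b c k = rising a k * rising b k / k ! * (rising c k)⁻¹ := by
  rw [gaussTerm, Gamma_add_natCast hc, mul_inv]
  field_simp [Complex.Gamma_ne_zero_of_re_pos hc]

theorem tendsto_inv_rising_add_natCast (c : ℂ) {k : ℕ} (hk : k ≠ 0) :
    Tendsto (fun n : ℕ => (rising (c + n) k)⁻¹) atTop (𝓝 0) := by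
  have hdeg : 0 < (ascPochhammer ℂ k).degree := by
    rw [← Polynomial.natDegree_pos_iff_degree_pos, ascPochhammer_natDegree]
    exact hk.pos
  refine tendsto_inv₀_cobounded.comp (tendsto_norm_atTop_iff_cobounded.1 ?_)
  refine Polynomial.tendsto_norm_atTop _ hdeg ?_
  refine tendsto_atTop_mono (fun n => Complex.re_le_norm _) ?_
  simpa using tendsto_atTop_add_const_left atTop c.re tendsto_natCast_atTop_atTop

theorem tendsto_Gamma_mul_tsum_gaussTerm_of_re_pos {a b c : ℂ} (hc : 0 < c.re)
    (h : 0 < (c - a - b).re) :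
    Tendsto (fun n : ℕ => Complex.Gamma (c + n) * ∑' k, gaussTerm a b (c + n) k) atTop (𝓝 1) := by
  simp_rw [← tsum_mul_left, Gamma_mul_gaussTerm (re_add_natCast_pos hc _)]
  rw [← tsum_ite_eq (0 : ℕ) fun _ => (1 : ℂ)]
  refine tendsto_tsum_of_dominated_convergence
    (bound := fun k => ‖rising a k * rising b k / k ! * (rising c k)⁻¹‖) ?_ (fun k => ?_)
    (Eventually.of_forall fun n k => ?_)
  · simpa only [Gamma_mul_gaussTerm hc] using
      ((summable_gaussTerm h).mul_left (Complex.Gamma c)).norm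
  · split_ifs with hk
    · simp [hk]
    · simpa using (tendsto_inv_rising_add_natCast c hk).const_mul (rising a k * rising b k / k !)
  · have hr : 0 < ‖rising c k‖ := norm_pos_iff.2 (rising_ne_zero (ne_neg_natCast_of_re_pos hc) k)
    rw [norm_mul, norm_mul _ (rising c k)⁻¹, norm_inv, norm_inv]
    gcongr
    exact norm_rising_le_norm_rising_add_natCast hc n k

theorem tendsto_Gamma_mul_tsum_gaussTerm {a b c : ℂ} (h : 0 < (c - a - b).re) :
    Tendsto (fun n : ℕ => Complex.Gamma (c + n) * ∑' k, gaussTerm a b (c + n) k) atTop (𝓝 1) := by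
  obtain ⟨N, hN⟩ := exists_nat_gt (-c.re)
  refine (tendsto_add_atTop_iff_nat N).1 ?_
  have hlim := tendsto_Gamma_mul_tsum_gaussTerm_of_re_pos (c := c + N)
    (by simpa using neg_lt_iff_pos_add'.1 hN) (re_add_natCast_sub_sub_pos h N)
  refine hlim.congr fun n => ?_
  push_cast
  ring_nf

theorem tsum_gaussTerm {a b c : ℂ} (h : 0 < (c - a - b).re) :
    ∑' n, gaussTerm a b c n =
      Complex.Gamma (c - a - b) * (Complex.Gamma (c - a))⁻¹ * (Complex.Gamma (c - b))⁻¹ := by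
  have hL := (tendsto_rising_div_gammaScale (c - a - b)).mul_const (∑' n, gaussTerm a b c n)
  have hR := (((tendsto_rising_div_gammaScale (c - a)).mul
    (tendsto_rising_div_gammaScale (c - b))).mul (tendsto_gammaScale_div_Gamma c)).mul
      (tendsto_Gamma_mul_tsum_gaussTerm h)
  have hlim := tendsto_nhds_unique_of_eventuallyEq hL hR ?_
  · rw [mul_one, mul_one, inv_mul_eq_iff_eq_mul₀ (Complex.Gamma_ne_zero_of_re_pos h)] at hlim
    rw [hlim, mul_assoc]
  filter_upwards [(tendsto_gammaScale_div_Gamma c).eventually_ne one_ne_zero] with n hn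
  have hG : Complex.Gamma (c + n) ≠ 0 := by simpa using right_ne_zero_of_mul hn
  have hs := gammaScale_sub_mul_gammaScale_sub a b c n
  have hiter := rising_mul_tsum_gaussTerm h n
  have h1 := gammaScale_ne_zero (c - a) n
  have h2 := gammaScale_ne_zero (c - b) n
  have h3 := gammaScale_ne_zero (c - a - b) n
  field_simp
  linear_combination (gammaScale (c - a) n * gammaScale (c - b) n) * hiter +
    rising (c - a) n * rising (c - b) n * (∑' k, gaussTerm a b (c + n) k) * hs

end GaussSummation

section PfaffTransformation

open Finset.HasAntidiagonal (antidiagonal mem_antidiagonal sigmaAntidiagonalEquivProd)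

theorem sum_antidiagonal_choose_mul_rising (N : ℕ) (a c : ℂ) :
    ∑ q ∈ antidiagonal N,
      (N.choose q.1 : ℂ) * ((-1) ^ q.1 * rising a q.1 * rising (c + q.1) q.2) =
      rising (c - a) N := by
  induction N generalizing a c with
  | zero => simp
  | succ N ih =>
    rw [Finset.sum_antidiagonal_choose_succ_mul
      fun i j => (-1) ^ i * rising a i * rising (c + i) j]
    have hleft : ∀ q ∈ antidiagonal N,
        (N.choose q.1 : ℂ) * ((-1) ^ q.1 * rising a q.1 * rising (c + q.1) (q.2 + 1)) =
        (c + N) * ((N.choose q.1 : ℂ) * ((-1) ^ q.1 * rising a q.1 * rising (c + q.1) q.2)) := by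
      intro q hq
      rw [rising_succ, ← mem_antidiagonal.1 hq]
      push_cast
      ring
    have hright : ∀ q ∈ antidiagonal N,
        (N.choose q.2 : ℂ) * ((-1) ^ (q.1 + 1) * rising a (q.1 + 1) *
          rising (c + (q.1 + 1 : ℕ)) q.2) =
        -a * ((N.choose q.1 : ℂ) * ((-1) ^ q.1 * rising (a + 1) q.1 *
          rising (c + 1 + q.1) q.2)) := by
      intro q hq
      rw [rising_succ_left, Nat.choose_symm_of_eq_add (mem_antidiagonal.1 hq).symm,
        show c + ((q.1 + 1 : ℕ) : ℂ) = c + 1 + q.1 by push_cast; ring]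
      ring
    rw [Finset.sum_congr rfl hleft, Finset.sum_congr rfl hright, ← Finset.mul_sum,
      ← Finset.mul_sum, ih, ih, rising_succ]
    ring_nf

theorem hasSum_rising_mul_pow (a : ℂ) {v : ℂ} (hv : ‖v‖ < 1) :
    HasSum (fun k : ℕ => rising a k / k ! * v ^ k) ((1 - v) ^ (-a)) := by
  have h := (Complex.one_div_one_sub_cpow_hasFPowerSeriesOnBall_zero a).hasSum
    (y := v) (by rw [← ENNReal.ofReal_one, Metric.eball_ofReal]; simpa using hv)
  simp only [zero_add] at h
  rw [one_div, ← Complex.cpow_neg] at h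
  convert! h using 2 with k
  simp only [FormalMultilinearSeries.ofScalars_apply_eq, smul_eq_mul]
  rw [Ring.choose_eq_smul, Polynomial.descPochhammer_smeval_eq_ascPochhammer,
    Polynomial.ascPochhammer_smeval_eq_eval, rising, smul_eq_mul,
    show a + k - 1 - k + 1 = a by ring]
  ring

theorem tsum_prod_eq_tsum_sum_antidiagonal {f : ℕ × ℕ → ℂ} (hf : Summable f) :
    ∑' q, f q = ∑' N, ∑ q ∈ antidiagonal N, f q := by
  have hs : Summable fun q => f (sigmaAntidiagonalEquivProd q) :=
    sigmaAntidiagonalEquivProd.summable_iff.2 hf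
  rw [← sigmaAntidiagonalEquivProd.tsum_eq f, hs.tsum_sigma' fun n => (hasSum_fintype _).summable]
  refine tsum_congr fun N => ?_
  rw [tsum_fintype]
  exact Finset.sum_finset_coe f (antidiagonal N)

/-- The array whose row sums give one side of Pfaff's transformation and whose antidiagonal sums
give the other. -/
noncomputable def pfaffArray (a b c v : ℂ) (q : ℕ × ℕ) : ℂ :=
  rising a (q.1 + q.2) * rising (c - b) q.1 * (-1) ^ q.1 /
    (rising c q.1 * (q.1 ! * q.2 !)) * v ^ (q.1 + q.2)

theorem factorial_add_le (m n : ℕ) : ((m + n)! : ℝ) ≤ 2 ^ (m + n) * (m ! * n !) := by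
  have h : (m + n)! ≤ 2 ^ (m + n) * (m ! * n !) := by
    rw [← Nat.add_choose_mul_factorial_mul_factorial, mul_assoc]
    exact Nat.mul_le_mul_right _ (Nat.choose_le_two_pow _ _)
  exact_mod_cast h

theorem pfaffArray_half_isBigO (a b : ℂ) {c : ℂ} (hc : ∀ k : ℕ, c ≠ -k) :
    pfaffArray a b c (1 / 2) =O[⊤] doubleWeight (-b.re) 0 (a.re - 1) := by
  have ha := isBigO_top_comp (rising_isBigO a) fun q : ℕ × ℕ => q.1 + q.2
  have hcb := isBigO_top_comp (rising_isBigO (c - b)) fun q : ℕ × ℕ => q.1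
  have hc' := isBigO_top_comp (inv_rising_isBigO hc) fun q : ℕ × ℕ => q.1
  have hfac : (fun q : ℕ × ℕ => (-1) ^ q.1 * (1 / 2) ^ (q.1 + q.2) / (q.1 ! * q.2 ! : ℂ)) =O[⊤]
      fun q => ((q.1 + q.2)! : ℝ)⁻¹ := by
    refine isBigO_of_le _ fun q => ?_
    have h := factorial_add_le q.1 q.2
    have h0 : (0 : ℝ) < (q.1 + q.2)! := by positivity
    simp only [norm_div, norm_mul, norm_pow, norm_neg, norm_one, one_pow, one_mul,
      Complex.norm_natCast, norm_inv, Real.norm_of_nonneg h0.le, Complex.norm_ofNat, one_div]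
    rw [inv_pow, ← one_div, div_div, one_div]
    gcongr
  refine ((((ha.mul hcb).mul hc').mul hfac).congr_left fun q => ?_).congr_right fun q => ?_
  · rw [pfaffArray]
    field_simp
  · have hm : (0 : ℝ) < (q.1 : ℝ) + 1 := by positivity
    have hp := Real.rpow_pos_of_pos hm
    simp only [gammaWeight, doubleWeight, Complex.sub_re, Real.rpow_zero, mul_one]
    rw [show c.re - b.re - 1 = -b.re + (c.re - 1) by ring, Real.rpow_add hm]
    push_cast
    have h1 := (hp (c.re - 1)).ne'
    field_simp

theorem summable_pfaffArray (a b : ℂ) {c v : ℂ} (hc : ∀ k : ℕ, c ≠ -k) (hv : ‖v‖ < 1 / 2) :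
    Summable (pfaffArray a b c v) := by
  have h2v : ‖2 * v‖ < 1 := by rw [norm_mul, Complex.norm_ofNat]; linarith
  refine (summable_mul_pow_of_isBigO_doubleWeight (pfaffArray_half_isBigO a b hc) h2v h2v).congr
    fun q => ?_
  have h : ((1 : ℂ) / 2) ^ (q.1 + q.2) * 2 ^ (q.1 + q.2) = 1 := by rw [← mul_pow]; norm_num
  simp only [pfaffArray]
  rw [mul_assoc _ ((2 * v) ^ q.1), ← pow_add, mul_pow, mul_assoc _ _ (2 ^ _ * _),
    ← mul_assoc _ (2 ^ _), h, one_mul]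

theorem tsum_pfaffArray_row (a b : ℂ) {c v : ℂ} (hv : ‖v‖ < 1) (n : ℕ) :
    ∑' k, pfaffArray a b c v (n, k) = (1 - v) ^ (-a) *
      (rising a n * rising (c - b) n / (rising c n * n !) * (v / (v - 1)) ^ n) := by
  have hv1 : 1 - v ≠ 0 := sub_ne_zero.2 fun h => by simp [← h] at hv
  have hterm (k : ℕ) : pfaffArray a b c v (n, k) =
      rising a n * rising (c - b) n * (-1) ^ n / (rising c n * n !) * v ^ n *
        (rising (a + n) k / k ! * v ^ k) := by
    simp only [pfaffArray]
    rw [rising_add, pow_add, mul_div_mul_comm]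
    field_simp
  simp_rw [hterm]
  rw [tsum_mul_left, (hasSum_rising_mul_pow (a + n) hv).tsum_eq, neg_add,
    Complex.cpow_add _ _ hv1, Complex.cpow_neg _ (n : ℂ), Complex.cpow_natCast,
    ← neg_sub 1 v, div_neg, neg_pow (v / (1 - v)), div_pow]
  ring

theorem sum_antidiagonal_pfaffArray (a b : ℂ) {c : ℂ} (hc : ∀ k : ℕ, c ≠ -k) (v : ℂ) (N : ℕ) :
    ∑ q ∈ antidiagonal N, pfaffArray a b c v q =
      rising a N * rising b N / (rising c N * N !) * v ^ N := by
  have hb := sum_antidiagonal_choose_mul_rising N (c - b) c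
  rw [sub_sub_cancel] at hb
  rw [← hb, Finset.mul_sum, Finset.sum_div, Finset.sum_mul]
  refine Finset.sum_congr rfl fun q hq => ?_
  obtain rfl := mem_antidiagonal.1 hq
  have hchoose : ((q.1 + q.2).choose q.1 : ℂ) * (q.1 ! * q.2 !) = (q.1 + q.2)! := by
    rw [Nat.choose_symm_add]
    exact_mod_cast (mul_assoc _ _ _).symm.trans
      (Nat.add_choose_mul_factorial_mul_factorial q.1 q.2)
  have hfac : ((q.1 + q.2)! : ℂ) ≠ 0 := by exact_mod_cast (q.1 + q.2).factorial_ne_zero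
  have hr := rising_ne_zero hc (q.1 + q.2)
  rw [← hchoose] at hfac
  rw [rising_add] at hr
  have := left_ne_zero_of_mul hfac
  have := right_ne_zero_of_mul hr
  have := left_ne_zero_of_mul hr
  rw [pfaffArray, ← hchoose, rising_add c]
  field_simp

theorem pfaff_transformation (a b : ℂ) {c v : ℂ} (hc : ∀ k : ℕ, c ≠ -k) (hv : ‖v‖ < 1 / 2) :
    ∑' n : ℕ, rising a n * rising b n / (rising c n * n !) * v ^ n =
      (1 - v) ^ (-a) *
        ∑' n : ℕ, rising a n * rising (c - b) n / (rising c n * n !) * (v / (v - 1)) ^ n := by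
  have hs := summable_pfaffArray a b hc hv
  simp_rw [← sum_antidiagonal_pfaffArray a b hc v]
  rw [← tsum_prod_eq_tsum_sum_antidiagonal hs, hs.tsum_prod,
    tsum_congr (tsum_pfaffArray_row a b (by linarith)), tsum_mul_left]

end PfaffTransformation

section AppellF3

/-- The coefficients of Appell's `F₃`. -/
noncomputable def appellF3Coeff (a a' b b' c : ℂ) (q : ℕ × ℕ) : ℂ :=
  (rising a q.1 * rising a' q.2 * rising b q.1 * rising b' q.2) /
    (rising c (q.1 + q.2) * q.1 ! * q.2 !)

/-- The coefficients of the double series in `u` and `v / (v - 1)` obtained from `F₃` by applying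
Pfaff's transformation to the inner sum over powers of `v`. -/
noncomputable def pfaffCoeff (a a' b b' c : ℂ) (q : ℕ × ℕ) : ℂ :=
  rising a q.1 * rising b q.1 * (rising a' q.2 * rising (c - b' + q.1) q.2) /
    (rising c (q.1 + q.2) * (q.1 ! * q.2 !))

/-- The Pfaff-transformed form of `F₃`, which continues it to `Re v < 1 / 2`. -/
noncomputable def appellF3Pfaff (a a' b b' c u v : ℂ) : ℂ :=
  (1 - v) ^ (-a') * ∑' q : ℕ × ℕ, pfaffCoeff a a' b b' c q * u ^ q.1 * (v / (v - 1)) ^ q.2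

theorem appellF3Series_eq_tsum (a a' b b' c u v : ℂ) :
    appellF3Series a a' b b' c u v = ∑' q, appellF3Coeff a a' b b' c q * u ^ q.1 * v ^ q.2 := rfl

theorem factorial_mul_factorial_le (m n : ℕ) : (m ! * n ! : ℝ) ≤ (m + n)! := by
  exact_mod_cast Nat.le_of_dvd (Nat.factorial_pos _)
    (Nat.factorial_mul_factorial_dvd_factorial_add m n)

theorem inv_factorial_mul_factorial_isBigO :
    (fun q : ℕ × ℕ => (q.1 ! * q.2 ! : ℂ)⁻¹) =O[⊤] fun q => (q.1 ! * q.2 ! : ℝ)⁻¹ :=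
  isBigO_of_le _ fun q => by simp

variable {c u v : ℂ} (a a' b b' : ℂ)

theorem appellF3Coeff_isBigO (hc : ∀ k : ℕ, c ≠ -k) :
    appellF3Coeff a a' b b' c =O[⊤]
      doubleWeight (a.re + b.re - 2) (a'.re + b'.re - 2) (1 - c.re) := by
  have hfst (z : ℂ) := isBigO_top_comp (rising_isBigO z) fun q : ℕ × ℕ => q.1
  have hsnd (z : ℂ) := isBigO_top_comp (rising_isBigO z) fun q : ℕ × ℕ => q.2
  have hcN := isBigO_top_comp (inv_rising_isBigO hc) fun q : ℕ × ℕ => q.1 + q.2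
  have hprod := ((((hfst a).mul (hsnd a')).mul (hfst b)).mul (hsnd b')).mul
    (hcN.mul inv_factorial_mul_factorial_isBigO)
  refine (hprod.congr_left fun q => ?_).trans (isBigO_of_le _ fun q => ?_)
  · rw [appellF3Coeff]
    ring
  · have hm : (0 : ℝ) < q.1 + 1 := by positivity
    have hn : (0 : ℝ) < q.2 + 1 := by positivity
    have hN : (0 : ℝ) < q.1 + q.2 + 1 := by positivity
    have hfac : (q.1 ! * q.2 ! : ℝ) / (q.1 + q.2)! ≤ 1 :=
      div_le_one_of_le₀ (factorial_mul_factorial_le _ _) (by positivity)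
    have heq : gammaWeight a.re q.1 * gammaWeight a'.re q.2 * gammaWeight b.re q.1 *
        gammaWeight b'.re q.2 * ((gammaWeight c.re (q.1 + q.2))⁻¹ * (q.1 ! * q.2 ! : ℝ)⁻¹) =
        (q.1 ! * q.2 ! : ℝ) / (q.1 + q.2)! *
          doubleWeight (a.re + b.re - 2) (a'.re + b'.re - 2) (1 - c.re) q := by
      simp only [gammaWeight, doubleWeight]
      rw [show a.re + b.re - 2 = (a.re - 1) + (b.re - 1) by ring,
        show a'.re + b'.re - 2 = (a'.re - 1) + (b'.re - 1) by ring,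
        show 1 - c.re = -(c.re - 1) by ring, Real.rpow_add hm, Real.rpow_add hn,
        Real.rpow_neg hN.le]
      push_cast
      field_simp
    rw [heq, norm_mul, Real.norm_of_nonneg (by positivity)]
    exact mul_le_of_le_one_left (norm_nonneg _) hfac

theorem pfaffCoeff_isBigO (hc : ∀ k : ℕ, c ≠ -k) :
    pfaffCoeff a a' b b' c =O[⊤]
      doubleWeight (a.re + b.re + b'.re - c.re - 1) (a'.re - 1) (-b'.re) := by
  have hfst (z : ℂ) := isBigO_top_comp (rising_isBigO z) fun q : ℕ × ℕ => q.1
  have hsnd := isBigO_top_comp (rising_isBigO a') fun q : ℕ × ℕ => q.2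
  have hcN := isBigO_top_comp (inv_rising_isBigO hc) fun q : ℕ × ℕ => q.1 + q.2
  have hprod := (((hfst a).mul (hfst b)).mul
    (hsnd.mul (rising_add_natCast_isBigO (c - b')))).mul
      (hcN.mul inv_factorial_mul_factorial_isBigO)
  refine (hprod.congr_left fun q => ?_).congr_right fun q => ?_
  · rw [pfaffCoeff]
    ring
  · have hm : (0 : ℝ) < q.1 + 1 := by positivity
    have hN : (0 : ℝ) < q.1 + q.2 + 1 := by positivity
    simp only [gammaWeight, doubleWeight, Complex.sub_re]
    rw [show a.re + b.re + b'.re - c.re - 1 = (a.re - 1) + (b.re - 1) - (c.re - b'.re - 1) by ring,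
      show -b'.re = (c.re - b'.re - 1) - (c.re - 1) by ring,
      Real.rpow_sub hm _ (c.re - b'.re - 1), Real.rpow_add hm, Real.rpow_sub hN _ (c.re - 1)]
    push_cast
    field_simp

theorem norm_div_sub_one_lt_one (hv : v.re < 1 / 2) : ‖v / (v - 1)‖ < 1 := by
  have h1 : v - 1 ≠ 0 := sub_ne_zero.2 fun h => by norm_num [h] at hv
  rw [norm_div, div_lt_one (norm_pos_iff.2 h1), Complex.norm_eq_sqrt_sq_add_sq,
    Complex.norm_eq_sqrt_sq_add_sq]
  refine Real.sqrt_lt_sqrt (by positivity) ?_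
  simp only [Complex.sub_re, Complex.one_re, Complex.sub_im, Complex.one_im, sub_zero]
  nlinarith

theorem add_natCast_ne_neg_natCast (hc : ∀ k : ℕ, c ≠ -k) (m k : ℕ) : c + m ≠ -k := fun h =>
  hc (k + m) (by push_cast; linear_combination h)

theorem appellF3Series_eq_appellF3Pfaff (hc : ∀ k : ℕ, c ≠ -k) (hu : ‖u‖ < 1)
    (hv : ‖v‖ < 1 / 2) : appellF3Series a a' b b' c u v = appellF3Pfaff a a' b b' c u v := by
  have hw := norm_div_sub_one_lt_one ((Complex.re_le_norm v).trans_lt hv)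
  have hsF := summable_mul_pow_of_isBigO_doubleWeight (appellF3Coeff_isBigO a a' b b' hc) hu
    (hv.trans (by norm_num))
  have hsP := summable_mul_pow_of_isBigO_doubleWeight (pfaffCoeff_isBigO a a' b b' hc) hu hw
  rw [appellF3Series_eq_tsum, appellF3Pfaff, hsF.tsum_prod, hsP.tsum_prod, ← tsum_mul_left]
  refine tsum_congr fun m => ?_
  have hleft (n : ℕ) : appellF3Coeff a a' b b' c (m, n) * u ^ m * v ^ n =
      rising a m * rising b m / (rising c m * m !) * u ^ m *
        (rising a' n * rising b' n / (rising (c + m) n * n !) * v ^ n) := by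
    rw [appellF3Coeff, rising_add]
    ring
  have hright (n : ℕ) : pfaffCoeff a a' b b' c (m, n) * u ^ m * (v / (v - 1)) ^ n =
      rising a m * rising b m / (rising c m * m !) * u ^ m *
        (rising a' n * rising (c + m - b') n / (rising (c + m) n * n !) * (v / (v - 1)) ^ n) := by
    rw [pfaffCoeff, rising_add c, show c - b' + m = c + m - b' by ring]
    ring
  simp_rw [hleft, hright, tsum_mul_left]
  rw [pfaff_transformation a' b' (add_natCast_ne_neg_natCast hc m) hv]
  ring

theorem differentiableOn_appellF3Pfaff (hc : ∀ k : ℕ, c ≠ -k) (hu : ‖u‖ < 1) :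
    DifferentiableOn ℂ (appellF3Pfaff a a' b b' c u) {v | v.re < 1 / 2} := by
  have hne : ∀ v ∈ {v : ℂ | v.re < 1 / 2}, v - 1 ≠ 0 := fun v hv =>
    sub_ne_zero.2 fun h => by norm_num [h] at hv
  refine DifferentiableOn.mul (DifferentiableOn.cpow_const (by fun_prop) fun v hv => .inl ?_) ?_
  · have hv : v.re < 1 / 2 := hv
    simp only [Complex.sub_re, Complex.one_re]
    linarith
  · exact (differentiableOn_tsum_of_isBigO_doubleWeight (pfaffCoeff_isBigO a a' b b' hc) hu).comp
      (f := fun v => v / (v - 1)) (DifferentiableOn.div (by fun_prop) (by fun_prop) hne)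
      fun v hv => mem_ball_zero_iff.2 (norm_div_sub_one_lt_one hv)

theorem analyticAt_comp_ofReal {f : ℂ → ℂ} {U : Set ℂ} (hf : DifferentiableOn ℂ f U)
    (hU : IsOpen U) {t : ℝ} (ht : (t : ℂ) ∈ U) : AnalyticAt ℝ (fun s : ℝ => f s) t :=
  (hf.analyticAt (hU.mem_nhds ht)).restrictScalars.fun_comp (Complex.ofRealCLM.analyticAt t)

theorem analyticAt_appellF3Series (hc : ∀ k : ℕ, c ≠ -k) (hu : ‖u‖ < 1) {t : ℝ}
    (ht : t ∈ Set.Ioo (-1 : ℝ) 1) :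
    AnalyticAt ℝ (fun s : ℝ => appellF3Series a a' b b' c u s) t :=
  analyticAt_comp_ofReal
    (differentiableOn_tsum_of_isBigO_doubleWeight (appellF3Coeff_isBigO a a' b b' hc) hu)
    Metric.isOpen_ball (by
      rwa [mem_ball_zero_iff, Complex.norm_real, Real.norm_eq_abs, abs_lt])

theorem analyticAt_appellF3Pfaff (hc : ∀ k : ℕ, c ≠ -k) (hu : ‖u‖ < 1) {t : ℝ} (ht : t < 1 / 2) :
    AnalyticAt ℝ (fun s : ℝ => appellF3Pfaff a a' b b' c u s) t :=
  analyticAt_comp_ofReal (differentiableOn_appellF3Pfaff a a' b b' hc hu)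
    (isOpen_lt Complex.continuous_re continuous_const) (by simpa using ht)

theorem eqOn_appellF3Series_appellF3Pfaff (hc : ∀ k : ℕ, c ≠ -k) (hu : ‖u‖ < 1) :
    Set.EqOn (fun t : ℝ => appellF3Series a a' b b' c u t)
      (fun t : ℝ => appellF3Pfaff a a' b b' c u t) (Set.Ioo (-1) (1 / 2)) := by
  refine AnalyticOnNhd.eqOn_of_preconnected_of_eventuallyEq
    (fun t ht => analyticAt_appellF3Series a a' b b' hc hu ⟨ht.1, ht.2.trans (by norm_num)⟩)
    (fun t ht => analyticAt_appellF3Pfaff a a' b b' hc hu ht.2)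
    isPreconnected_Ioo (z₀ := 0) (by norm_num) ?_
  filter_upwards [Ioo_mem_nhds (show (-(1 / 2) : ℝ) < 0 by norm_num)
    (show (0 : ℝ) < 1 / 2 by norm_num)] with t ht
  exact appellF3Series_eq_appellF3Pfaff a a' b b' hc hu (by
    rwa [Complex.norm_real, Real.norm_eq_abs, abs_lt])

theorem isAppellF3Continuation_ite (hc : ∀ k : ℕ, c ≠ -k) (hu : ‖u‖ < 1) :
    IsAppellF3Continuation a a' b b' c u fun t : ℝ =>
      if t < 1 / 2 then appellF3Pfaff a a' b b' c u t else appellF3Series a a' b b' c u t := by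
  set g : ℝ → ℂ := fun t =>
    if t < 1 / 2 then appellF3Pfaff a a' b b' c u t else appellF3Series a a' b b' c u t
  have hser : Set.EqOn g (fun t : ℝ => appellF3Series a a' b b' c u t) (Set.Ioo (-1) 1) := by
    intro t ht
    rcases lt_or_ge t (1 / 2) with h | h
    · exact (if_pos h).trans (eqOn_appellF3Series_appellF3Pfaff a a' b b' hc hu ⟨ht.1, h⟩).symm
    · exact if_neg h.not_gt
  refine ⟨fun t ht => ?_, hser⟩
  rcases lt_or_ge t (1 / 2) with h | h
  · refine (analyticAt_appellF3Pfaff a a' b b' hc hu h).congr ?_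
    filter_upwards [Iio_mem_nhds h] with s hs using (if_pos hs).symm
  · have ht' : t ∈ Set.Ioo (-1 : ℝ) 1 := ⟨by linarith, ht⟩
    exact (analyticAt_appellF3Series a a' b b' hc hu ht').congr
      (hser.symm.eventuallyEq_of_mem (Ioo_mem_nhds ht'.1 ht'.2))

theorem appellF3_eq_appellF3Pfaff (hc : ∀ k : ℕ, c ≠ -k) (hu : ‖u‖ < 1) {t : ℝ}
    (ht : t < 1 / 2) : appellF3 a a' b b' c u t = appellF3Pfaff a a' b b' c u t := by
  have hg := isAppellF3Continuation_ite a a' b b' hc hu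
  have hex : ∃ g : ℝ → ℂ, IsAppellF3Continuation a a' b b' c u g := ⟨_, hg⟩
  rw [appellF3, dif_pos hex,
    hex.choose_spec.eqOn hg (show t ∈ Set.Iio 1 from ht.trans (by norm_num))]
  exact if_pos ht

end AppellF3

section TermwiseIntegration

variable {α ι 𝕜 : Type*} [MeasurableSpace α] {ν : Measure α} [RCLike 𝕜] {K : α → 𝕜}
  {g : ι → α → 𝕜} {B : ι → ℝ}

theorem summable_integral_norm_mul_of_norm_le (hK : Integrable K ν) (hB : Summable B)
    (hgB : ∀ i, ∀ᵐ a ∂ν, ‖g i a‖ ≤ B i) : Summable fun i => ∫ a, ‖K a * g i a‖ ∂ν := by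
  refine .of_nonneg_of_le (fun i => integral_nonneg fun a => norm_nonneg _) (fun i => ?_)
    (hB.mul_left (∫ a, ‖K a‖ ∂ν))
  rw [← integral_mul_const]
  refine integral_mono_of_nonneg (ae_of_all _ fun a => norm_nonneg _) (hK.norm.mul_const _)
    ((hgB i).mono fun a ha => ?_)
  simp only [norm_mul]
  gcongr

variable [Countable ι]

theorem integrable_tsum_of_summable_integral_norm {E : Type*} [NormedAddCommGroup E]
    [CompleteSpace E] {F : ι → α → E} (hF : ∀ i, Integrable (F i) ν)
    (hF_sum : Summable fun i => ∫ a, ‖F i a‖ ∂ν) :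
    Integrable (fun a => ∑' i, F i a) ν := by
  have hfin : ∫⁻ a, ∑' i, ‖F i a‖ₑ ∂ν < ⊤ := by
    rw [lintegral_tsum fun i => (hF i).1.enorm]
    simp_rw [← ofReal_integral_norm_eq_lintegral_enorm (hF _)]
    exact hF_sum.tsum_ofReal_lt_top
  have hs : ∀ᵐ a ∂ν, Summable fun i => ‖F i a‖ :=
    (ae_lt_top' (AEMeasurable.tsum fun i => (hF i).1.enorm) hfin.ne).mono fun a ha =>
      tsum_enorm_ne_top_iff_summable_norm.1 ha.ne
  refine ⟨aestronglyMeasurable_of_tendsto_ae atTop (f := fun (s : Finset ι) a => ∑ i ∈ s, F i a)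
    (fun s => Finset.aestronglyMeasurable_fun_sum s fun i _ => (hF i).1) ?_, ?_⟩
  · filter_upwards [hs] with a ha using ha.of_norm.hasSum
  · exact (lintegral_mono fun a => enorm_tsum_le_tsum_enorm).trans_lt hfin

theorem integrable_mul_tsum_of_norm_le (hK : Integrable K ν)
    (hg : ∀ i, AEStronglyMeasurable (g i) ν) (hB : Summable B)
    (hgB : ∀ i, ∀ᵐ a ∂ν, ‖g i a‖ ≤ B i) : Integrable (fun a => K a * ∑' i, g i a) ν := by
  simp_rw [← tsum_mul_left]
  exact integrable_tsum_of_summable_integral_norm (fun i => hK.mul_bdd (hg i) (hgB i))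
    (summable_integral_norm_mul_of_norm_le hK hB hgB)

theorem hasSum_integral_mul_of_norm_le (hK : Integrable K ν)
    (hg : ∀ i, AEStronglyMeasurable (g i) ν) (hB : Summable B)
    (hgB : ∀ i, ∀ᵐ a ∂ν, ‖g i a‖ ≤ B i) :
    HasSum (fun i => ∫ a, K a * g i a ∂ν) (∫ a, K a * ∑' i, g i a ∂ν) := by
  simp_rw [← tsum_mul_left]
  exact hasSum_integral_of_summable_integral_norm (fun i => hK.mul_bdd (hg i) (hgB i))
    (summable_integral_norm_mul_of_norm_le hK hB hgB)

end TermwiseIntegration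

section BetaTransform

/-- The integrand of Euler's beta integral. -/
noncomputable def betaIntegrand (z w : ℂ) (u : ℝ) : ℂ :=
  (u : ℂ) ^ (z - 1) * (1 - (u : ℂ)) ^ (w - 1)

theorem setIntegral_betaIntegrand (z w : ℂ) :
    ∫ u in Set.Ioo (0 : ℝ) 1, betaIntegrand z w u = Complex.betaIntegral z w := by
  rw [Complex.betaIntegral, intervalIntegral.integral_of_le zero_le_one,
    integral_Ioc_eq_integral_Ioo]
  rfl

theorem setIntegral_norm_betaIntegrand (z w : ℂ) :
    ((∫ u in Set.Ioo (0 : ℝ) 1, ‖betaIntegrand z w u‖ : ℝ) : ℂ) =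
      Complex.betaIntegral z.re w.re := by
  rw [← setIntegral_betaIntegrand, ← integral_complex_ofReal]
  refine setIntegral_congr_fun measurableSet_Ioo fun u hu => ?_
  have hu1 : 0 < 1 - u := sub_pos.2 hu.2
  have hcast : 1 - (u : ℂ) = ((1 - u : ℝ) : ℂ) := by push_cast; rfl
  simp only [betaIntegrand]
  rw [norm_mul, hcast, Complex.norm_cpow_eq_rpow_re_of_pos hu.1,
    Complex.norm_cpow_eq_rpow_re_of_pos hu1, Complex.ofReal_mul, Complex.ofReal_cpow hu.1.le,
    Complex.ofReal_cpow hu1.le]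
  simp

theorem betaIntegrand_add_natCast (z w : ℂ) {u : ℝ} (hu : u ≠ 0) (n : ℕ) :
    betaIntegrand (z + n) w u = betaIntegrand z w u * (u : ℂ) ^ n := by
  rw [betaIntegrand, betaIntegrand, add_sub_right_comm,
    Complex.cpow_add _ _ (Complex.ofReal_ne_zero.2 hu), Complex.cpow_natCast]
  ring

variable {z w : ℂ}

theorem integrableOn_betaIntegrand (hz : 0 < z.re) (hw : 0 < w.re) :
    IntegrableOn (betaIntegrand z w) (Set.Ioo 0 1) :=
  (intervalIntegrable_iff_integrableOn_Ioo_of_le zero_le_one).1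
    (Complex.betaIntegral_convergent hz hw)

theorem betaIntegral_add_natCast (hz : 0 < z.re) (hw : 0 < w.re) (n : ℕ) :
    Complex.betaIntegral (z + n) w =
      Complex.Gamma z * Complex.Gamma w * (rising z n * (Complex.Gamma (z + w + n))⁻¹) := by
  have h := Complex.Gamma_mul_Gamma_eq_betaIntegral (re_add_natCast_pos hz n) hw
  have hG : Complex.Gamma (z + n + w) ≠ 0 := Complex.Gamma_ne_zero_of_re_pos
    (Complex.add_re (z + n) w ▸ add_pos (re_add_natCast_pos hz n) hw)
  rw [Gamma_add_natCast hz] at h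
  rw [add_right_comm z w]
  field_simp
  linear_combination -h

theorem betaIntegral_add_natCast_isBigO (hz : 0 < z.re) (hw : 0 < w.re) :
    (fun n : ℕ => Complex.betaIntegral (z + n) w) =O[⊤] fun n : ℕ => ((n : ℝ) + 1) ^ (-w.re) := by
  have h := ((rising_isBigO z).mul (inv_Gamma_add_natCast_isBigO (z + w))).const_mul_left
    (Complex.Gamma z * Complex.Gamma w)
  refine (h.congr_left fun n => (betaIntegral_add_natCast hz hw n).symm).congr_right fun n => ?_
  have hn : (0 : ℝ) < n + 1 := by positivity
  rw [gammaWeight, gammaWeight, Complex.add_re, show -w.re = z.re - 1 - (z.re + w.re - 1) by ring,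
    Real.rpow_sub hn _ (z.re + w.re - 1)]
  field_simp

variable {ι : Type*} {d : ι → ℂ} {e : ι → ℕ}

theorem summable_integral_norm_mul_betaIntegrand (hz : 0 < z.re) (hw : 0 < w.re)
    (hd : Summable fun i => ‖d i‖ * ((e i : ℝ) + 1) ^ (-w.re)) :
    Summable fun i => ∫ u in Set.Ioo (0 : ℝ) 1, ‖d i * betaIntegrand (z + e i) w u‖ := by
  have hbeta := isBigO_top_comp (betaIntegral_add_natCast_isBigO (z := (z.re : ℂ))
    (w := (w.re : ℂ)) (by simpa) (by simpa)) e
  refine summable_of_isBigO hd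
    ((((isBigO_refl (fun i => ‖d i‖) ⊤).mul hbeta.norm_left).congr_left fun i => ?_).mono le_top)
  have hval := setIntegral_norm_betaIntegrand (z + e i) w
  rw [show ((z + e i).re : ℂ) = z.re + e i by simp] at hval
  simp_rw [norm_mul]
  rw [← hval, integral_const_mul, Complex.norm_real,
    Real.norm_of_nonneg (integral_nonneg fun u => norm_nonneg _)]

theorem betaIntegrand_mul_tsum (z w : ℂ) {u : ℝ} (hu : u ≠ 0) :
    betaIntegrand z w u * ∑' i, d i * (u : ℂ) ^ e i =
      ∑' i, d i * betaIntegrand (z + e i) w u := by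
  rw [← tsum_mul_left]
  refine tsum_congr fun i => ?_
  rw [betaIntegrand_add_natCast z w hu]
  ring

variable [Countable ι]

theorem integrableOn_betaIntegrand_mul_tsum (hz : 0 < z.re) (hw : 0 < w.re)
    (hd : Summable fun i => ‖d i‖ * ((e i : ℝ) + 1) ^ (-w.re)) :
    IntegrableOn (fun u : ℝ => betaIntegrand z w u * ∑' i, d i * (u : ℂ) ^ e i) (Set.Ioo 0 1) :=
  (integrableOn_congr_fun (fun _ hu => betaIntegrand_mul_tsum z w hu.1.ne') measurableSet_Ioo).2 <|
    integrable_tsum_of_summable_integral_norm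
      (fun i => (integrableOn_betaIntegrand (re_add_natCast_pos hz (e i)) hw).const_mul (d i))
      (summable_integral_norm_mul_betaIntegrand hz hw hd)

theorem hasSum_mul_betaIntegral (hz : 0 < z.re) (hw : 0 < w.re)
    (hd : Summable fun i => ‖d i‖ * ((e i : ℝ) + 1) ^ (-w.re)) :
    HasSum (fun i => d i * Complex.betaIntegral (z + e i) w)
      (∫ u in Set.Ioo (0 : ℝ) 1, betaIntegrand z w u * ∑' i, d i * (u : ℂ) ^ e i) := by
  rw [setIntegral_congr_fun measurableSet_Ioo fun _ hu => betaIntegrand_mul_tsum z w hu.1.ne']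
  simp_rw [← setIntegral_betaIntegrand, ← integral_const_mul]
  exact hasSum_integral_of_summable_integral_norm
    (fun i => (integrableOn_betaIntegrand (re_add_natCast_pos hz (e i)) hw).const_mul (d i))
    (summable_integral_norm_mul_betaIntegrand hz hw hd)

end BetaTransform

section PfaffBetaTransform

/-- The value at the point `(u, u)` of the Pfaff-transformed double series of `F₃`. The substitution
`u = 1 - t / x` sends both series variables `1 - t / x` and `v / (v - 1)`, `v = 1 - x / t`, to `u`,
so this is the series in the kernel of the Marichev–Saigo–Maeda integral. -/
noncomputable def pfaffDiag (a a' b b' c u : ℂ) : ℂ :=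
  ∑' q : ℕ × ℕ, pfaffCoeff a a' b b' c q * u ^ (q.1 + q.2)

/-- The quotient of Gamma functions giving the image of `t ^ (s - 1)` under the
Marichev–Saigo–Maeda integral with parameters `(a, a', b, b', c)`, up to a power of `x`. -/
noncomputable def gammaQuotient (a a' b b' c s : ℂ) : ℂ :=
  Complex.Gamma s * Complex.Gamma (s + c - a - a' - b) * Complex.Gamma (s + b' - a') *
    ((Complex.Gamma (s + b'))⁻¹ * (Complex.Gamma (s + c - a - a'))⁻¹ *
      (Complex.Gamma (s + c - a' - b))⁻¹)

variable {a a' b b' c s : ℂ}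

theorem tsum_gaussTerm_gaussTerm (h₁ : 0 < (s + c - a - a' - b).re) (h₂ : 0 < (s + b' - a').re) :
    ∑' m : ℕ, rising a m * rising b m / m ! *
        ∑' n : ℕ, gaussTerm a' (c - b' + m) (c + s + m) n =
      Complex.Gamma (s + c - a - a' - b) * Complex.Gamma (s + b' - a') *
        ((Complex.Gamma (s + b'))⁻¹ * (Complex.Gamma (s + c - a - a'))⁻¹ *
          (Complex.Gamma (s + c - a' - b))⁻¹) := by
  have hinner (m : ℕ) : rising a m * rising b m / m ! *
      ∑' n : ℕ, gaussTerm a' (c - b' + m) (c + s + m) n =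
      Complex.Gamma (s + b' - a') * (Complex.Gamma (s + b'))⁻¹ *
        gaussTerm a b (c + s - a') m := by
    have hpar : c + s + m - a' - (c - b' + m) = s + b' - a' := by ring
    rw [tsum_gaussTerm (by rwa [hpar]), hpar, show c + s + m - (c - b' + m) = s + b' by ring,
      show c + s + m - a' = c + s - a' + m by ring, gaussTerm]
    ring
  have hpar : c + s - a' - a - b = s + c - a - a' - b := by ring
  simp_rw [hinner, tsum_mul_left]
  rw [tsum_gaussTerm (by rwa [hpar]), hpar, show c + s - a' - a = s + c - a - a' by ring,
    show c + s - a' - b = s + c - a' - b by ring]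
  ring

theorem pfaffCoeff_mul_betaIntegral (a a' b b' : ℂ) (hc : 0 < c.re) (hs : 0 < s.re) (m n : ℕ) :
    pfaffCoeff a a' b b' c (m, n) * Complex.betaIntegral (c + (m + n : ℕ)) s =
      Complex.Gamma c * Complex.Gamma s *
        (rising a m * rising b m / m ! * gaussTerm a' (c - b' + m) (c + s + m) n) := by
  have hr := rising_ne_zero (ne_neg_natCast_of_re_pos hc) (m + n)
  rw [betaIntegral_add_natCast hc hs, pfaffCoeff, gaussTerm, Nat.cast_add, ← add_assoc (c + s)]
  field_simp

theorem tsum_pfaffCoeff_mul_betaIntegral (hc : 0 < c.re) (hs : 0 < s.re)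
    (hsum : Summable fun q : ℕ × ℕ =>
      pfaffCoeff a a' b b' c q * Complex.betaIntegral (c + (q.1 + q.2 : ℕ)) s)
    (h₁ : 0 < (s + c - a - a' - b).re) (h₂ : 0 < (s + b' - a').re) :
    ∑' q : ℕ × ℕ, pfaffCoeff a a' b b' c q * Complex.betaIntegral (c + (q.1 + q.2 : ℕ)) s =
      Complex.Gamma c * gammaQuotient a a' b b' c s := by
  rw [hsum.tsum_prod]
  simp_rw [pfaffCoeff_mul_betaIntegral a a' b b' hc hs, tsum_mul_left,
    tsum_gaussTerm_gaussTerm h₁ h₂, gammaQuotient]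
  ring

theorem summable_norm_pfaffCoeff_mul_rpow (hc : ∀ k : ℕ, c ≠ -k) (ha' : 0 < a'.re)
    (h₁ : 0 < (s + c - a - a' - b).re) (h₂ : 0 < (s + b' - a').re) :
    Summable fun q : ℕ × ℕ =>
      ‖pfaffCoeff a a' b b' c q‖ * (((q.1 + q.2 : ℕ) : ℝ) + 1) ^ (-s.re) := by
  simp only [Complex.add_re, Complex.sub_re] at h₁ h₂
  have hbound := (pfaffCoeff_isBigO a a' b b' hc).norm_left.mul
    (isBigO_refl (fun q : ℕ × ℕ => (((q.1 + q.2 : ℕ) : ℝ) + 1) ^ (-s.re)) ⊤)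
  refine summable_of_isBigO (summable_doubleWeight (α := a.re + b.re + b'.re - c.re - 1)
    (β := a'.re - 1) (δ := -b'.re + -s.re) (by linarith) (by linarith) (by linarith))
    ((hbound.congr_right fun q => ?_).mono le_top)
  simp only [doubleWeight, Nat.cast_add]
  rw [Real.rpow_add (show (0 : ℝ) < q.1 + q.2 + 1 by positivity), ← mul_assoc]

theorem pfaffCoeff_contiguous (a a' b b' : ℂ) (hc : ∀ k : ℕ, c ≠ -k) (m n : ℕ) :
    pfaffCoeff a a' b b' c (m, n + 1) = pfaffCoeff a (a' + 1) b b' c (m, n + 1) -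
      pfaffCoeff a (a' + 1) b b' c (m, n) +
        b' / c * pfaffCoeff a (a' + 1) b (b' + 1) (c + 1) (m, n) := by
  have hc0 : c ≠ 0 := by simpa using hc 0
  have hcN : c + (m + n : ℕ) ≠ 0 := by simpa using add_natCast_ne_neg_natCast hc (m + n) 0
  have hr := rising_ne_zero hc (m + n)
  have hshift : rising (c + 1) (m + n) = rising c (m + n) * (c + (m + n : ℕ)) / c := by
    rw [← rising_succ, rising_succ_left]; field_simp
  have hn : (n : ℂ) + 1 ≠ 0 := by exact_mod_cast n.succ_ne_zero
  simp only [pfaffCoeff]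
  rw [← add_assoc m n 1, rising_succ c, hshift, rising_succ_left a', rising_succ (c - b' + m),
    rising_succ (a' + 1), Nat.factorial_succ, show c + 1 - (b' + 1) = c - b' by ring]
  push_cast at hcN ⊢
  field_simp
  ring

theorem summable_pfaffDiag (a a' b b' : ℂ) (hc : ∀ k : ℕ, c ≠ -k) {u : ℂ} (hu : ‖u‖ < 1) :
    Summable fun q : ℕ × ℕ => pfaffCoeff a a' b b' c q * u ^ (q.1 + q.2) := by
  simpa only [mul_assoc, ← pow_add] using
    summable_mul_pow_of_isBigO_doubleWeight (pfaffCoeff_isBigO a a' b b' hc) hu hu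

theorem pfaffCoeff_zero_right (a a' b b' c : ℂ) (m : ℕ) :
    pfaffCoeff a a' b b' c (m, 0) = rising a m * rising b m / (rising c m * m !) := by
  simp [pfaffCoeff]

theorem pfaffDiag_contiguous (a a' b b' : ℂ) (hc : ∀ k : ℕ, c ≠ -k) {u : ℂ} (hu : ‖u‖ < 1) :
    pfaffDiag a a' b b' c u = (1 - u) * pfaffDiag a (a' + 1) b b' c u +
      b' / c * u * pfaffDiag a (a' + 1) b (b' + 1) (c + 1) u := by
  have hc1 : ∀ k : ℕ, c + 1 ≠ -k := by simpa using add_natCast_ne_neg_natCast hc 1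
  have hs₀ := summable_pfaffDiag a a' b b' hc hu
  have hs₁ := summable_pfaffDiag a (a' + 1) b b' hc hu
  have hs₂ := summable_pfaffDiag a (a' + 1) b (b' + 1) hc1 hu
  simp only [pfaffDiag]
  rw [hs₀.tsum_prod, hs₁.tsum_prod, hs₂.tsum_prod, ← tsum_mul_left, ← tsum_mul_left,
    ← (hs₁.prod.mul_left _).tsum_add (hs₂.prod.mul_left _)]
  refine tsum_congr fun m => ?_
  have hm₀ := hs₀.prod_factor m
  have hm₁ := hs₁.prod_factor m
  have hm₂ := hs₂.prod_factor m
  have hm₁' := (summable_nat_add_iff 1).2 hm₁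
  rw [sub_mul, one_mul, hm₀.tsum_eq_zero_add]
  nth_rewrite 1 [hm₁.tsum_eq_zero_add]
  rw [pfaffCoeff_zero_right, pfaffCoeff_zero_right, ← tsum_mul_left, ← tsum_mul_left,
    add_sub_assoc, add_assoc, ← hm₁'.tsum_sub (hm₁.mul_left u),
    ← (hm₁'.sub (hm₁.mul_left u)).tsum_add (hm₂.mul_left _)]
  congr 1
  refine tsum_congr fun n => ?_
  rw [pfaffCoeff_contiguous a a' b b' hc, ← add_assoc m n 1, pow_succ]
  ring

theorem gammaQuotient_contiguous (a a' b b' c : ℂ) (hs : s ≠ 0) :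
    gammaQuotient a a' b b' c s = gammaQuotient a (a' + 1) b b' c (s + 1) +
      b' * gammaQuotient a (a' + 1) b (b' + 1) (c + 1) s := by
  simp only [gammaQuotient]
  rw [Complex.one_div_Gamma_eq_self_mul_one_div_Gamma_add_one (s + b'), Complex.Gamma_add_one s hs]
  ring_nf

theorem betaIntegrand_mul_pfaffDiag_contiguous (a a' b b' : ℂ) (hc : ∀ k : ℕ, c ≠ -k) (s : ℂ)
    {u : ℝ} (hu : u ∈ Set.Ioo (0 : ℝ) 1) :
    betaIntegrand c (s + 1) u * pfaffDiag a (a' + 1) b b' c u +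
        b' / c * (betaIntegrand (c + 1) s u * pfaffDiag a (a' + 1) b (b' + 1) (c + 1) u) =
      betaIntegrand c s u * pfaffDiag a a' b b' c u := by
  have hu0 : (u : ℂ) ≠ 0 := Complex.ofReal_ne_zero.2 hu.1.ne'
  have hu1 : 1 - (u : ℂ) ≠ 0 := sub_ne_zero.2 (by exact_mod_cast hu.2.ne')
  have hnorm : ‖(u : ℂ)‖ < 1 := by
    rw [Complex.norm_real, Real.norm_of_nonneg hu.1.le]; exact hu.2
  rw [pfaffDiag_contiguous a a' b b' hc hnorm]
  simp only [betaIntegrand, add_sub_right_comm _ (1 : ℂ) 1]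
  rw [Complex.cpow_add _ _ hu0, Complex.cpow_add _ _ hu1, Complex.cpow_one, Complex.cpow_one]
  ring

theorem integrableOn_and_setIntegral_betaIntegrand_mul_pfaffDiag_of_re_pos (ha' : 0 < a'.re)
    (hc : 0 < c.re) (hs : 0 < s.re) (h₁ : 0 < (s + c - a - a' - b).re)
    (h₂ : 0 < (s + b' - a').re) :
    IntegrableOn (fun u : ℝ => betaIntegrand c s u * pfaffDiag a a' b b' c u) (Set.Ioo 0 1) ∧
      ∫ u in Set.Ioo (0 : ℝ) 1, betaIntegrand c s u * pfaffDiag a a' b b' c u =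
        Complex.Gamma c * gammaQuotient a a' b b' c s := by
  have hd := summable_norm_pfaffCoeff_mul_rpow (ne_neg_natCast_of_re_pos hc) ha' h₁ h₂
  have hsum := hasSum_mul_betaIntegral hc hs hd
  refine ⟨integrableOn_betaIntegrand_mul_tsum hc hs hd, ?_⟩
  rw [← tsum_pfaffCoeff_mul_betaIntegral hc hs hsum.summable h₁ h₂]
  exact hsum.tsum_eq.symm

theorem integrableOn_and_setIntegral_betaIntegrand_mul_pfaffDiag (hc : 0 < c.re) (hs : 0 < s.re)
    (h₁ : 0 < (s + c - a - a' - b).re) (h₂ : 0 < (s + b' - a').re) :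
    IntegrableOn (fun u : ℝ => betaIntegrand c s u * pfaffDiag a a' b b' c u) (Set.Ioo 0 1) ∧
      ∫ u in Set.Ioo (0 : ℝ) 1, betaIntegrand c s u * pfaffDiag a a' b b' c u =
        Complex.Gamma c * gammaQuotient a a' b b' c s := by
  obtain ⟨k, hk⟩ := exists_nat_gt (-a'.re)
  induction k generalizing a' b' c s with
  | zero =>
    exact integrableOn_and_setIntegral_betaIntegrand_mul_pfaffDiag_of_re_pos (by simpa using hk)
      hc hs h₁ h₂
  | succ k ih =>
    have ha' : -(a' + 1).re < k := by
      push_cast at hk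
      rw [Complex.add_re, Complex.one_re]
      linarith
    have hcne := ne_neg_natCast_of_re_pos hc
    have hc0 : c ≠ 0 := by simpa using hcne 0
    have hs0 : s ≠ 0 := by simpa using ne_neg_natCast_of_re_pos hs 0
    obtain ⟨hint₁, hval₁⟩ := ih (b' := b') hc (s := s + 1)
      (by simpa using re_add_natCast_pos hs 1)
      (by rwa [show s + 1 + c - a - (a' + 1) - b = s + c - a - a' - b by ring])
      (by rwa [show s + 1 + b' - (a' + 1) = s + b' - a' by ring]) ha'
    obtain ⟨hint₂, hval₂⟩ := ih (b' := b' + 1) (c := c + 1)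
      (by simpa using re_add_natCast_pos hc 1) hs
      (by rwa [show s + (c + 1) - a - (a' + 1) - b = s + c - a - a' - b by ring])
      (by rwa [show s + (b' + 1) - (a' + 1) = s + b' - a' by ring]) ha'
    have hcont : Set.EqOn _ _ (Set.Ioo (0 : ℝ) 1) := fun u hu =>
      betaIntegrand_mul_pfaffDiag_contiguous a a' b b' hcne s hu
    refine ⟨(integrableOn_congr_fun hcont measurableSet_Ioo).1 (hint₁.add (hint₂.const_mul _)), ?_⟩
    rw [← setIntegral_congr_fun measurableSet_Ioo hcont,
      integral_add hint₁ (hint₂.const_mul _), integral_const_mul, hval₁, hval₂,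
      gammaQuotient_contiguous a a' b b' c hs0, Complex.Gamma_add_one c hc0]
    field_simp

end PfaffBetaTransform

section MarichevSaigoMaeda

variable {γ : ℂ} {x t : ℝ} (lam lam' ξ ξ' : ℂ)

theorem msmIntegrand_mul (γ : ℂ) (f g : ℝ → ℂ) (x t : ℝ) :
    msmIntegrand lam lam' ξ ξ' γ (fun t => f t * g t) x t =
      msmIntegrand lam lam' ξ ξ' γ f x t * g t :=
  (mul_assoc _ _ _).symm

theorem eqOn_msmIntegrand (γ : ℂ) {f g : ℝ → ℂ} (hfg : Set.EqOn f g (Set.Ioi 0)) (hx : 0 ≤ x) :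
    Set.EqOn (msmIntegrand lam lam' ξ ξ' γ f x) (msmIntegrand lam lam' ξ ξ' γ g x)
      (Set.uIoc 0 x) := fun t ht => by
  rw [Set.uIoc_of_le hx] at ht
  rw [msmIntegrand, msmIntegrand, hfg ht.1]

theorem msmIntegral_congr (γ : ℂ) {f g : ℝ → ℂ} (hfg : Set.EqOn f g (Set.Ioi 0)) (hx : 0 ≤ x) :
    msmIntegral lam lam' ξ ξ' γ f x = msmIntegral lam lam' ξ ξ' γ g x := by
  rw [msmIntegral, msmIntegral, intervalIntegral.integral_congr_ae
    (ae_of_all _ fun _ ht => eqOn_msmIntegrand lam lam' ξ ξ' γ hfg hx ht)]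

theorem msmIntegrand_eq_mul_pfaffDiag (hγ : ∀ k : ℕ, γ ≠ -k) (f : ℝ → ℂ)
    (ht : t ∈ Set.Ioc 0 x) :
    msmIntegrand lam lam' ξ ξ' γ f x t = (x : ℂ) ^ (-lam') * ((x - t : ℝ) : ℂ) ^ (γ - 1) *
      pfaffDiag lam lam' ξ ξ' γ ((1 - t / x : ℝ) : ℂ) * f t := by
  obtain ⟨ht0, htx⟩ := ht
  have hx := ht0.trans_le htx
  have hxc : (x : ℂ) ≠ 0 := Complex.ofReal_ne_zero.2 hx.ne'
  have htc : (t : ℂ) ≠ 0 := Complex.ofReal_ne_zero.2 ht0.ne'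
  have hu : ‖((1 - t / x : ℝ) : ℂ)‖ < 1 := by
    have h0 := div_pos ht0 hx
    have h1 := (div_le_one hx).2 htx
    rw [Complex.norm_real, Real.norm_eq_abs, abs_lt]
    constructor <;> linarith
  have hv : 1 - x / t < 1 / 2 := by
    have h1 := (one_le_div ht0).2 htx
    linarith
  have hone_sub : 1 - ((1 - x / t : ℝ) : ℂ) = ((x / t : ℝ) : ℂ) := by push_cast; ring
  have hpfaff : ((1 - x / t : ℝ) : ℂ) / (((1 - x / t : ℝ) : ℂ) - 1) = ((1 - t / x : ℝ) : ℂ) := by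
    rw [← neg_sub 1 (((1 - x / t : ℝ) : ℂ)), hone_sub]
    push_cast
    field_simp
    ring
  have hpow : (t : ℂ) ^ (-lam') * ((x / t : ℝ) : ℂ) ^ (-lam') = (x : ℂ) ^ (-lam') := by
    rw [← Complex.mul_cpow_ofReal_nonneg ht0.le (div_pos hx ht0).le, ← Complex.ofReal_mul,
      mul_div_cancel₀ _ ht0.ne']
  rw [msmIntegrand, appellF3_eq_appellF3Pfaff lam lam' ξ ξ' hγ hu hv, appellF3Pfaff, hone_sub,
    hpfaff, pfaffDiag, ← hpow]
  simp only [pow_add, mul_assoc]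
  ring

theorem msmIntegrand_cpow_eq_mul_betaIntegrand (s : ℂ) (hγ : ∀ k : ℕ, γ ≠ -k)
    (ht : t ∈ Set.Ioc 0 x) :
    msmIntegrand lam lam' ξ ξ' γ (fun t : ℝ => (t : ℂ) ^ (s - 1)) x t =
      (x : ℂ) ^ (s + γ - lam' - 2) *
        (betaIntegrand γ s (1 - t / x) * pfaffDiag lam lam' ξ ξ' γ ((1 - t / x : ℝ) : ℂ)) := by
  have hx := ht.1.trans_le ht.2
  have hxc : (x : ℂ) ≠ 0 := Complex.ofReal_ne_zero.2 hx.ne'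
  have hscale {y : ℝ} (hy : 0 ≤ y) (z : ℂ) : ((x * y : ℝ) : ℂ) ^ z = (x : ℂ) ^ z * (y : ℂ) ^ z := by
    rw [Complex.ofReal_mul, Complex.mul_cpow_ofReal_nonneg hx.le hy]
  have hpow_sub := hscale (sub_nonneg.2 ((div_le_one hx).2 ht.2)) (γ - 1)
  have hpow := hscale (div_pos ht.1 hx).le (s - 1)
  rw [mul_div_cancel₀ _ hx.ne'] at hpow
  rw [mul_sub, mul_one, mul_div_cancel₀ _ hx.ne'] at hpow_sub
  rw [msmIntegrand_eq_mul_pfaffDiag lam lam' ξ ξ' hγ _ ht, betaIntegrand, hpow_sub, hpow,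
    show 1 - ((1 - t / x : ℝ) : ℂ) = ((t / x : ℝ) : ℂ) by push_cast; ring,
    show s + γ - lam' - 2 = (s - 1) + (γ - 1) + -lam' by ring, Complex.cpow_add _ _ hxc,
    Complex.cpow_add _ _ hxc]
  ring

variable {lam lam' ξ ξ'} {s : ℂ}

theorem intervalIntegrable_msmIntegrand_cpow (hγ : 0 < γ.re) (hs : 0 < s.re)
    (h₁ : 0 < (s + γ - lam - lam' - ξ).re) (h₂ : 0 < (s + ξ' - lam').re) (hx : 0 ≤ x) :
    IntervalIntegrable (msmIntegrand lam lam' ξ ξ' γ (fun t : ℝ => (t : ℂ) ^ (s - 1)) x)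
      volume 0 x := by
  have hbeta := (intervalIntegrable_iff_integrableOn_Ioo_of_le zero_le_one).2
    (integrableOn_and_setIntegral_betaIntegrand_mul_pfaffDiag hγ hs h₁ h₂).1
  have hscaled := (hbeta.comp_sub_left 1).symm.comp_mul_left (c := x⁻¹)
  simp only [sub_self, sub_zero, zero_div, one_div, inv_inv, inv_mul_eq_div] at hscaled
  refine (hscaled.const_mul ((x : ℂ) ^ (s + γ - lam' - 2))).congr fun t ht => ?_
  rw [Set.uIoc_of_le hx] at ht
  exact (msmIntegrand_cpow_eq_mul_betaIntegrand lam lam' ξ ξ' s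
    (ne_neg_natCast_of_re_pos hγ) ht).symm

theorem msmIntegral_cpow (hγ : 0 < γ.re) (hs : 0 < s.re)
    (h₁ : 0 < (s + γ - lam - lam' - ξ).re) (h₂ : 0 < (s + ξ' - lam').re) (hx : 0 < x) :
    msmIntegral lam lam' ξ ξ' γ (fun t : ℝ => (t : ℂ) ^ (s - 1)) x =
      (x : ℂ) ^ (s + γ - lam - lam' - 1) * gammaQuotient lam lam' ξ ξ' γ s := by
  have hxc : (x : ℂ) ≠ 0 := Complex.ofReal_ne_zero.2 hx.ne'
  have hG : Complex.Gamma γ ≠ 0 := Complex.Gamma_ne_zero_of_re_pos hγ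
  have hbeta := (integrableOn_and_setIntegral_betaIntegrand_mul_pfaffDiag hγ hs h₁ h₂).2
  have hcongr : ∫ t in (0 : ℝ)..x,
      msmIntegrand lam lam' ξ ξ' γ (fun t : ℝ => (t : ℂ) ^ (s - 1)) x t =
      ∫ t in (0 : ℝ)..x, (x : ℂ) ^ (s + γ - lam' - 2) *
        (betaIntegrand γ s (1 - t / x) * pfaffDiag lam lam' ξ ξ' γ ((1 - t / x : ℝ) : ℂ)) :=
    intervalIntegral.integral_congr_ae (ae_of_all _ fun t ht =>
      msmIntegrand_cpow_eq_mul_betaIntegrand lam lam' ξ ξ' s (ne_neg_natCast_of_re_pos hγ)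
        (Set.uIoc_of_le hx.le ▸ ht))
  rw [msmIntegral, hcongr, intervalIntegral.integral_const_mul,
    intervalIntegral.integral_comp_sub_div
      (fun u => betaIntegrand γ s u * pfaffDiag lam lam' ξ ξ' γ u) hx.ne' 1,
    zero_div, sub_zero, div_self hx.ne', sub_self, intervalIntegral.integral_of_le zero_le_one,
    integral_Ioc_eq_integral_Ioo, hbeta, Complex.real_smul,
    show s + γ - lam - lam' - 1 = -lam + (s + γ - lam' - 2) + 1 by ring, Complex.cpow_add _ _ hxc,
    Complex.cpow_add _ _ hxc, Complex.cpow_one]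
  field_simp

variable {ι : Type*} [Countable ι] {d : ι → ℂ} {e : ι → ℕ} {f : ℝ → ℂ}

theorem ae_norm_mul_pow_le (d : ℂ) (n : ℕ) (x : ℝ) :
    ∀ᵐ t : ℝ ∂volume.restrict (Set.Ioc 0 x), ‖d * (t : ℂ) ^ n‖ ≤ ‖d‖ * x ^ n :=
  (ae_restrict_mem measurableSet_Ioc).mono fun t ht => by
    rw [norm_mul, norm_pow, Complex.norm_real, Real.norm_of_nonneg ht.1.le]
    gcongr
    exacts [ht.1.le, ht.2]

theorem intervalIntegrable_msmIntegrand_mul_tsum (hx : 0 ≤ x)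
    (hf : IntervalIntegrable (msmIntegrand lam lam' ξ ξ' γ f x) volume 0 x)
    (hd : Summable fun i => ‖d i‖ * x ^ e i) :
    IntervalIntegrable
      (msmIntegrand lam lam' ξ ξ' γ (fun t => f t * ∑' i, d i * (t : ℂ) ^ e i) x) volume 0 x := by
  rw [intervalIntegrable_iff_integrableOn_Ioc_of_le hx] at hf ⊢
  simp_rw [funext (msmIntegrand_mul lam lam' ξ ξ' γ f _ x)]
  exact integrable_mul_tsum_of_norm_le hf (fun i => by fun_prop) hd
    fun i => ae_norm_mul_pow_le (d i) (e i) x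

theorem hasSum_msmIntegral_mul_pow (hx : 0 ≤ x)
    (hf : IntervalIntegrable (msmIntegrand lam lam' ξ ξ' γ f x) volume 0 x)
    (hd : Summable fun i => ‖d i‖ * x ^ e i) :
    HasSum (fun i => d i * msmIntegral lam lam' ξ ξ' γ (fun t => f t * (t : ℂ) ^ e i) x)
      (msmIntegral lam lam' ξ ξ' γ (fun t => f t * ∑' i, d i * (t : ℂ) ^ e i) x) := by
  rw [intervalIntegrable_iff_integrableOn_Ioc_of_le hx] at hf
  have hsum := (hasSum_integral_mul_of_norm_le hf (fun i => by fun_prop) hd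
    fun i => ae_norm_mul_pow_le (d i) (e i) x).mul_left ((x : ℂ) ^ (-lam) / Complex.Gamma γ)
  simp_rw [msmIntegral, intervalIntegral.integral_of_le hx, msmIntegrand_mul]
  refine hsum.congr_fun fun i => ?_
  simp_rw [mul_left_comm _ (d i), integral_const_mul]
  ring

end MarichevSaigoMaeda

section GammaDecay

theorem inv_Gamma_ofReal_add_isBigO_rpow_neg (μ : ℂ) {Q : ℝ} (hQ : 0 < Q) :
    (fun y : ℝ => (Complex.Gamma (y + μ))⁻¹) =O[𝓟 (Set.Ici 0)] fun y => Q ^ (-y) := by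
  set h : ℝ → ℝ := fun y => Q ^ y * ‖(Complex.Gamma (y + μ))⁻¹‖ with hdef
  obtain ⟨N, hN⟩ := exists_nat_ge (Q - μ.re)
  have hstep : ∀ y : ℝ, N ≤ y → h (y + 1) ≤ h y := by
    intro y hy
    have hnorm : Q ≤ ‖(y : ℂ) + μ‖ := by
      refine le_trans ?_ (Complex.re_le_norm _)
      rw [Complex.add_re, Complex.ofReal_re]
      linarith
    simp only [hdef]
    rw [Complex.one_div_Gamma_eq_self_mul_one_div_Gamma_add_one (y + μ), norm_mul,
      Real.rpow_add_one hQ.ne', Complex.ofReal_add, Complex.ofReal_one, add_right_comm, mul_assoc]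
    gcongr
  have hcont : Continuous h := (Real.continuous_const_rpow hQ.ne').mul
    (Complex.differentiable_one_div_Gamma.continuous.comp (by fun_prop)).norm
  obtain ⟨C, hC⟩ := (isCompact_Icc (a := (0 : ℝ)) (b := N + 1)).bddAbove_image hcont.continuousOn
  have hbound (n : ℕ) : ∀ y ∈ Set.Icc (0 : ℝ) (N + 1 + n), h y ≤ C := by
    induction n with
    | zero => exact fun y hy => hC (Set.mem_image_of_mem h (by simpa using hy))
    | succ n ih =>
      intro y hy
      push_cast at hy
      rcases le_or_gt y (N + 1 + n) with hle | hlt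
      · exact ih y ⟨hy.1, hle⟩
      · have hNy : (N : ℝ) ≤ y - 1 := by linarith [n.cast_nonneg (α := ℝ)]
        have hy1 := hstep (y - 1) hNy
        rw [sub_add_cancel] at hy1
        exact hy1.trans (ih (y - 1) ⟨N.cast_nonneg.trans hNy, by linarith [hy.2]⟩)
  refine IsBigO.of_bound C (eventually_principal.2 fun y hy => ?_)
  obtain ⟨n, hn⟩ := exists_nat_ge y
  have hy := hbound n y ⟨hy, by linarith [N.cast_nonneg (α := ℝ)]⟩
  rw [Real.norm_of_nonneg (by positivity), Real.rpow_neg hQ.le, ← div_eq_mul_inv,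
    le_div_iff₀ (by positivity), mul_comm]
  exact hy

theorem inv_Gamma_mul_natCast_add_isBigO (μ : ℂ) {α : ℝ} (hα : 0 ≤ α) {Q : ℝ} (hQ : 0 < Q) :
    (fun k : ℕ => (Complex.Gamma (α * k + μ))⁻¹) =O[⊤] fun k => (Q ^ (-α)) ^ k := by
  have h := (inv_Gamma_ofReal_add_isBigO_rpow_neg μ hQ).comp_tendsto (k := fun k : ℕ => α * k)
    (l' := ⊤) (tendsto_principal.2 (Eventually.of_forall fun k => by
      simp only [Set.mem_Ici]; positivity))
  refine (h.congr_left fun k => ?_).congr_right fun k => ?_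
  · simp
  · rw [Function.comp_apply, ← neg_mul, Real.rpow_mul_natCast hQ.le]

theorem summable_norm_inv_Gamma_mul_inv_Gamma_mul_pow (μ ν : ℂ) {α β : ℝ} (hα : 0 < α)
    (hβ : 0 ≤ β) (R : ℝ) : Summable fun k : ℕ =>
      ‖(Complex.Gamma (α * k + μ))⁻¹ * (Complex.Gamma (β * k + ν))⁻¹‖ * R ^ k := by
  set Q : ℝ := (|R| + 1) ^ α⁻¹ with hQdef
  have hR : 0 < |R| + 1 := by positivity
  have hQ : 0 < Q := by positivity
  have hQR : Q ^ (-α) = (|R| + 1)⁻¹ := by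
    rw [hQdef, ← Real.rpow_mul hR.le, mul_neg, inv_mul_cancel₀ hα.ne', Real.rpow_neg_one]
  have hbound := ((inv_Gamma_mul_natCast_add_isBigO μ hα.le hQ).mul
    (inv_Gamma_mul_natCast_add_isBigO ν hβ one_pos)).norm_left.mul
      (isBigO_refl (fun k : ℕ => R ^ k) ⊤)
  refine summable_of_isBigO (summable_geometric_of_abs_lt_one (r := (|R| + 1)⁻¹ * R) ?_)
    ((hbound.congr_right fun k => ?_).mono le_top)
  · rw [abs_mul, abs_inv, abs_of_pos hR, inv_mul_lt_one₀ hR]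
    exact lt_add_one _
  · rw [hQR, Real.one_rpow, one_pow, mul_one, mul_pow]

end GammaDecay

section Struve

/-- The coefficient of `z ^ (2 * k)` in `z ^ (-(p + 1))` times the generalized Struve function. -/
noncomputable def struveCoeff (a : ℕ) (α : ℝ) (μ p b c σ : ℂ) (k : ℕ) : ℂ :=
  (-c) ^ k / (Complex.Gamma ((α : ℂ) * k + μ) *
    Complex.Gamma ((a : ℂ) * k + p / σ + (b + 2) / 2)) / (2 : ℂ) ^ (2 * (k : ℂ) + p + 1)

variable (a : ℕ) {α : ℝ} (μ p b c σ : ℂ)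

theorem two_cpow_two_mul_natCast_add (p : ℂ) (k : ℕ) :
    (2 : ℂ) ^ (2 * (k : ℂ) + p + 1) = 4 ^ k * 2 ^ (p + 1) := by
  rw [add_assoc, Complex.cpow_add _ _ two_ne_zero, ← Nat.cast_ofNat, ← Nat.cast_mul,
    Complex.cpow_natCast, pow_mul]
  norm_num

theorem summable_norm_struveCoeff_mul_pow (hα : 0 < α) (x : ℝ) :
    Summable fun k => ‖struveCoeff a α μ p b c σ k‖ * x ^ (2 * k) := by
  refine ((summable_norm_inv_Gamma_mul_inv_Gamma_mul_pow μ (p / σ + (b + 2) / 2) hα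
    a.cast_nonneg (‖c‖ * x ^ 2 / 4)).mul_left ‖((2 : ℂ) ^ (p + 1))⁻¹‖).congr fun k => ?_
  rw [struveCoeff, two_cpow_two_mul_natCast_add, add_assoc ((a : ℂ) * k)]
  simp only [norm_div, norm_mul, norm_pow, norm_neg, norm_inv, Complex.ofReal_natCast,
    Complex.norm_ofNat, div_pow, mul_pow, pow_mul]
  ring

theorem struveTerm_ofReal (α : ℝ) {t : ℝ} (ht : 0 < t) (k : ℕ) :
    struveTerm a α μ p b c σ t k =
      (t : ℂ) ^ (p + 1) * (struveCoeff a α μ p b c σ k * (t : ℂ) ^ (2 * k)) := by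
  have htc : (t : ℂ) ≠ 0 := Complex.ofReal_ne_zero.2 ht.ne'
  have hdiv : ((t : ℂ) / 2) ^ (2 * (k : ℂ) + p + 1) =
      (t : ℂ) ^ (2 * k) * (t : ℂ) ^ (p + 1) / 2 ^ (2 * (k : ℂ) + p + 1) := by
    have h := Complex.div_cpow_ofReal_nonneg ht.le zero_le_two (2 * (k : ℂ) + p + 1)
    rw [Complex.ofReal_ofNat] at h
    rw [h, ← Complex.cpow_natCast, ← Complex.cpow_add _ _ htc]
    push_cast
    ring_nf
  rw [struveTerm, struveCoeff, hdiv]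
  ring

theorem summable_struveTerm_ofReal (hα : 0 < α) {t : ℝ} (ht : 0 < t) :
    Summable (struveTerm a α μ p b c σ t) := by
  rw [funext (struveTerm_ofReal a μ p b c σ α ht)]
  refine .mul_left _ (.of_norm ((summable_norm_struveCoeff_mul_pow a μ p b c σ hα t).congr
    fun k => ?_))
  rw [norm_mul, norm_pow, Complex.norm_real, Real.norm_of_nonneg ht.le]

theorem cpow_mul_generalizedStruve_ofReal (ρ : ℂ) (α : ℝ) {t : ℝ} (ht : 0 < t) :
    (t : ℂ) ^ (ρ - 1) * generalizedStruve a α μ p b c σ t =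
      (t : ℂ) ^ (ρ + p + 1 - 1) * ∑' k, struveCoeff a α μ p b c σ k * (t : ℂ) ^ (2 * k) := by
  rw [generalizedStruve, tsum_congr (struveTerm_ofReal a μ p b c σ α ht), tsum_mul_left,
    ← mul_assoc, ← Complex.cpow_add _ _ (Complex.ofReal_ne_zero.2 ht.ne'),
    show ρ - 1 + (p + 1) = ρ + p + 1 - 1 by ring]

theorem struveCoeff_mul_gammaQuotient (lam lam' ξ ξ' γ ρ : ℂ) (α x : ℝ) (k : ℕ) :
    struveCoeff a α μ p b c σ k *
        ((x : ℂ) ^ (2 * k) * gammaQuotient lam lam' ξ ξ' γ (ρ + p + 1 + (2 * k : ℕ))) =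
      foxWrightTerm (imageUpper lam lam' ξ ξ' γ ρ p)
        (imageLower lam lam' ξ ξ' γ ρ a α μ p b σ) (-(c * (x : ℂ) ^ 2) / 4) k / 2 ^ (p + 1) := by
  have hfac : Complex.Gamma (1 + (k : ℂ)) = k ! := by
    rw [add_comm, Complex.Gamma_nat_eq_factorial]
  have hk : (k ! : ℂ) ≠ 0 := Nat.cast_ne_zero.2 k.factorial_ne_zero
  simp only [foxWrightTerm, imageUpper, imageLower, Fin.prod_univ_four, Fin.prod_univ_five,
    Matrix.cons_val, Complex.ofReal_ofNat, Complex.ofReal_one, one_mul, Complex.ofReal_natCast,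
    hfac, struveCoeff, gammaQuotient, two_cpow_two_mul_natCast_add, Nat.cast_mul, Nat.cast_ofNat]
  rw [show ρ + p + 1 + γ - lam - lam' - ξ + 2 * (k : ℂ) =
      ρ + p + 1 + 2 * k + γ - lam - lam' - ξ by ring,
    show ρ + p + 1 + ξ' - lam' + 2 * (k : ℂ) = ρ + p + 1 + 2 * k + ξ' - lam' by ring,
    show ρ + p + 1 + ξ' + 2 * (k : ℂ) = ρ + p + 1 + 2 * k + ξ' by ring,
    show ρ + p + 1 + γ - lam - lam' + 2 * (k : ℂ) = ρ + p + 1 + 2 * k + γ - lam - lam' by ring,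
    show ρ + p + 1 + γ - lam' - ξ + 2 * (k : ℂ) = ρ + p + 1 + 2 * k + γ - lam' - ξ by ring,
    add_comm μ, add_comm (p / σ + (b + 2) / 2), ← add_assoc _ (p / σ),
    show -(c * (x : ℂ) ^ 2) / 4 = -c * (x : ℂ) ^ 2 / 4 by ring, div_pow, mul_pow, ← pow_mul]
  simp only [div_eq_mul_inv, mul_inv]
  rw [mul_right_comm _ (k ! : ℂ), mul_mul_mul_comm _ (k ! : ℂ), mul_inv_cancel₀ hk, mul_one]
  ring

end Struve

section StruveImage

variable {lam lam' ξ ξ' γ ρ : ℂ} (a : ℕ) {α : ℝ} (μ : ℂ) {p : ℂ} (b c σ : ℂ) {x : ℝ}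

theorem msmIntegral_cpow_mul_pow {s : ℂ} (hγ : 0 < γ.re) (hs : 0 < s.re)
    (h₁ : 0 < (s + γ - lam - lam' - ξ).re) (h₂ : 0 < (s + ξ' - lam').re) (hx : 0 < x) (n : ℕ) :
    msmIntegral lam lam' ξ ξ' γ (fun t => (t : ℂ) ^ (s - 1) * (t : ℂ) ^ n) x =
      (x : ℂ) ^ (s + γ - lam - lam' - 1) *
        ((x : ℂ) ^ n * gammaQuotient lam lam' ξ ξ' γ (s + n)) := by
  have hpow : Set.EqOn (fun t : ℝ => (t : ℂ) ^ (s - 1) * (t : ℂ) ^ n)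
      (fun t : ℝ => (t : ℂ) ^ (s + n - 1)) (Set.Ioi 0) := fun t ht => by
    beta_reduce
    rw [add_sub_right_comm, Complex.cpow_add _ _ (Complex.ofReal_ne_zero.2 ht.ne'),
      Complex.cpow_natCast]
  have h₁n : 0 < (s + n + γ - lam - lam' - ξ).re := by
    rw [show s + n + γ - lam - lam' - ξ = s + γ - lam - lam' - ξ + n by ring]
    exact re_add_natCast_pos h₁ n
  have h₂n : 0 < (s + n + ξ' - lam').re := by
    rw [show s + n + ξ' - lam' = s + ξ' - lam' + n by ring]
    exact re_add_natCast_pos h₂ n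
  rw [msmIntegral_congr lam lam' ξ ξ' γ hpow hx.le,
    msmIntegral_cpow hγ (re_add_natCast_pos hs n) h₁n h₂n hx,
    show s + n + γ - lam - lam' - 1 = s + γ - lam - lam' - 1 + n by ring,
    Complex.cpow_add _ _ (Complex.ofReal_ne_zero.2 hx.ne'), Complex.cpow_natCast, mul_assoc]

theorem hasSum_foxWrightTerm_msmIntegral (hγ : 0 < γ.re) (hα : 0 < α) (hs : 0 < (ρ + p + 1).re)
    (h₁ : 0 < (ρ + p + 1 + γ - lam - lam' - ξ).re) (h₂ : 0 < (ρ + p + 1 + ξ' - lam').re)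
    (hx : 0 < x) :
    HasSum (fun k => (x : ℂ) ^ (ρ + p - lam - lam' + γ) / (2 : ℂ) ^ (p + 1) *
        foxWrightTerm (imageUpper lam lam' ξ ξ' γ ρ p)
          (imageLower lam lam' ξ ξ' γ ρ a α μ p b σ) (-(c * (x : ℂ) ^ 2) / 4) k)
      (msmIntegral lam lam' ξ ξ' γ
        (fun t : ℝ => (t : ℂ) ^ (ρ - 1) * generalizedStruve a α μ p b c σ t) x) := by
  rw [msmIntegral_congr lam lam' ξ ξ' γ
    (fun t ht => cpow_mul_generalizedStruve_ofReal a μ p b c σ ρ α ht) hx.le]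
  refine (hasSum_msmIntegral_mul_pow hx.le (intervalIntegrable_msmIntegrand_cpow hγ hs h₁ h₂ hx.le)
    (summable_norm_struveCoeff_mul_pow a μ p b c σ hα x)).congr_fun fun k => ?_
  rw [msmIntegral_cpow_mul_pow hγ hs h₁ h₂ hx, mul_left_comm, struveCoeff_mul_gammaQuotient,
    show ρ + p + 1 + γ - lam - lam' - 1 = ρ + p - lam - lam' + γ by ring]
  ring

theorem intervalIntegrable_msmIntegrand_cpow_mul_generalizedStruve (hγ : 0 < γ.re) (hα : 0 < α)
    (hs : 0 < (ρ + p + 1).re) (h₁ : 0 < (ρ + p + 1 + γ - lam - lam' - ξ).re)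
    (h₂ : 0 < (ρ + p + 1 + ξ' - lam').re) (hx : 0 ≤ x) :
    IntervalIntegrable (msmIntegrand lam lam' ξ ξ' γ
      (fun t : ℝ => (t : ℂ) ^ (ρ - 1) * generalizedStruve a α μ p b c σ t) x) volume 0 x :=
  (intervalIntegrable_msmIntegrand_mul_tsum hx
    (intervalIntegrable_msmIntegrand_cpow hγ hs h₁ h₂ hx)
    (summable_norm_struveCoeff_mul_pow a μ p b c σ hα x)).congr <|
      eqOn_msmIntegrand lam lam' ξ ξ' γ
        (fun _ ht => (cpow_mul_generalizedStruve_ofReal a μ p b c σ ρ α ht).symm) hx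

end StruveImage

theorem theorem1 (lam lam' ξ ξ' γ ρ : ℂ) (a : ℕ) (α : ℝ) (μ p b c σ : ℂ)
    (hγ : 0 < γ.re) (hα : 0 < α) (hσ : σ ≠ 0)
    (hρ : max (max 0 (lam + lam' + ξ - γ).re) (lam' - ξ').re < (ρ + p + 1).re)
    (x : ℝ) (hx : 0 < x) :
    (∀ t : ℝ, 0 < t → Summable (struveTerm a α μ p b c σ (t : ℂ))) ∧
    IntervalIntegrable
      (msmIntegrand lam lam' ξ ξ' γ
        (fun t : ℝ => (t : ℂ) ^ (ρ - 1) * generalizedStruve a α μ p b c σ (t : ℂ)) x)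
      MeasureTheory.volume 0 x ∧
    Summable (foxWrightTerm (imageUpper lam lam' ξ ξ' γ ρ p)
      (imageLower lam lam' ξ ξ' γ ρ a α μ p b σ) (-(c * (x : ℂ) ^ 2) / 4)) ∧
    msmIntegral lam lam' ξ ξ' γ
        (fun t : ℝ => (t : ℂ) ^ (ρ - 1) * generalizedStruve a α μ p b c σ (t : ℂ)) x =
      (x : ℂ) ^ (ρ + p - lam - lam' + γ) / (2 : ℂ) ^ (p + 1) *
        foxWright (imageUpper lam lam' ξ ξ' γ ρ p)
          (imageLower lam lam' ξ ξ' γ ρ a α μ p b σ) (-(c * (x : ℂ) ^ 2) / 4) := by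
  obtain ⟨⟨hs, h₁⟩, h₂⟩ : (0 < (ρ + p + 1).re ∧ 0 < (ρ + p + 1 + γ - lam - lam' - ξ).re) ∧
      0 < (ρ + p + 1 + ξ' - lam').re := by
    simp only [max_lt_iff, Complex.add_re, Complex.sub_re, Complex.one_re] at hρ ⊢
    refine ⟨⟨hρ.1.1, ?_⟩, ?_⟩ <;> linarith
  have hsum := hasSum_foxWrightTerm_msmIntegral a μ b c σ hγ hα hs h₁ h₂ hx
  have hconst : (x : ℂ) ^ (ρ + p - lam - lam' + γ) / (2 : ℂ) ^ (p + 1) ≠ 0 :=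
    div_ne_zero (Complex.cpow_ne_zero_iff.2 (.inl (Complex.ofReal_ne_zero.2 hx.ne')))
      (Complex.cpow_ne_zero_iff.2 (.inl two_ne_zero))
  exact ⟨fun t ht => summable_struveTerm_ofReal a μ p b c σ hα ht,
    intervalIntegrable_msmIntegrand_cpow_mul_generalizedStruve a μ b c σ hγ hα hs h₁ h₂ hx.le,
    (summable_mul_left_iff hconst).1 hsum.summable, by
      rw [foxWright, ← tsum_mul_left, hsum.tsum_eq]⟩
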